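/- Let $\mathbb K$ be a field of characteristic $0$ and let $\mathcal H_{rt}$ be the bialgebra of rooted trees: the polynomial $\mathbb K$-algebra on the isomorphism classes of (finite, nonempty, non-planar) rooted trees, with counit $\epsilon$ killing every tree and coproduct the algebra map determined by $$\Delta(T)=T\otimes 1+1\otimes T+\sum_{c}P_c\otimes R_c ,$$ where $c$ runs over the nonempty admissible cuts of $T$ (sets of edges meeting every path from the root to a leaf at most once), $R_c$ is the component of the root after removing the edges in $c$, and $P_c$ is the product of the other components. Let $\mathcal A$ be a commutative, associative, unital $\mathbb K$-algebra and $R:\mathcal A\to\mathcal A$ a $\mathbb K$-linear Rota–Baxter map of weight $1$, i.e. $R(x)R(y)+R(xy)=R(R(x)y+xR(y))$; put $\tilde R=\mathrm{id}-R$. Let $L=L(\mathcal H_{rt},\mathcal A)$ be the algebra of $\mathbb K$-linear maps with the convolution product $f\star g=m_{\mathcal A}(f\otimes g)\Delta$ and $[f,g]=f\star g-g\star f$, and put $\mathcal R(f)=R\circ f$, $\tilde{\mathcal R}(f)=\tilde R\circ f$. An infinitesimal character is a map $Z\in L$ with $Z(xy)=Z(x)\epsilon(y)+\epsilon(x)Z(y)$.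 Let $\exp^\star(Z)=\sum_{k\ge0}Z^{\star k}/k!$, and let $$BCH(a,b)=\sum_{k\ge1}c_kK^{(k)}(a,b)=\tfrac12[a,b]+\tfrac1{12}\big([a,[a,b]]-[b,[a,b]]\big)+\cdots$$ be the Baker–Campbell–Hausdorff Lie series without its linear part, where $c_kK^{(k)}$ is its part of degree $k+1$: explicitly $c_kK^{(k)}=z_{k+1}$, where $z_0=0$, $z_1=a+b$ and, with the Bernoulli numbers $B_{2p}$, $$(n+1)z_{n+1}=\tfrac12[a-b,z_n]+\sum_{p\ge1}\frac{B_{2p}}{(2p)!}\sum_{\substack{k_1,\dots,k_{2p}\ge1\\k_1+\cdots+k_{2p}=n}}[z_{k_1},[z_{k_2},\cdots[z_{k_{2p}},a+b]\cdots]]\qquad(n\ge1).$$ For infinitesimal characters these series are finite sums on every element of $\mathcal H_{rt}$. Let $Z\in L$ be an infinitesimal character. There is exactly one formal power series $\chi(u;Z)=\sum_{n\ge0}u^n\chi^{(n)}_Z\in L[[u]]$ with $$\chi(u;Z)=Z-\sum_{k\ge1}u^k c_kK^{(k)}\big(\mathcal R(\chi(u;Z)),\tilde{\mathcal R}(\chi(u;Z))\big)$$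 ($\mathcal R,\tilde{\mathcal R}$ acting on coefficients). On every element of $\mathcal H_{rt}$ only finitely many $\chi^{(n)}_Z$ are nonzero, and $\chi(Z):=\chi(1;Z)=\sum_n\chi^{(n)}_Z$ is an infinitesimal character. It is the only infinitesimal character with $\chi=Z-BCH(\mathcal R(\chi),\tilde{\mathcal R}(\chi))$, and $$\exp^\star(Z)=\exp^\star\big(\mathcal R(\chi(Z))\big)\star\exp^\star\big(\tilde{\mathcal R}(\chi(Z))\big).$$ -/

import Mathlib

namespace CK

open scoped TensorProduct

/-- A finite rooted tree with a chosen numbering of the branches at every vertex: the root carries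
branches indexed by `Fin n`, each of which is again such a tree.  The one-vertex tree is `n = 0`. -/
inductive PlaneTree : Type
  | node {n : ℕ} (branch : Fin n → PlaneTree) : PlaneTree

/-- Isomorphism of rooted trees (the numbering of the branches is ignored): a bijection between the
branches at the roots under which corresponding branches are isomorphic. -/
inductive PlaneTree.Iso : PlaneTree → PlaneTree → Prop
  | node {n m : ℕ} {b : Fin n → PlaneTree} {b' : Fin m → PlaneTree} (σ : Fin n ≃ Fin m)
      (h : ∀ i, Iso (b i) (b' (σ i))) : Iso (.node b) (.node b')

theorem PlaneTree.Iso.refl (t : PlaneTree) : Iso t t := by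
  induction t with
  | node b ih => exact .node (Equiv.refl _) ih

theorem PlaneTree.Iso.symm {s t : PlaneTree} (h : Iso s t) : Iso t s := by
  induction h with
  | node σ _ ih => exact .node σ.symm fun i => by simpa using ih (σ.symm i)

theorem PlaneTree.Iso.trans {s t u : PlaneTree} (h : Iso s t) (h' : Iso t u) : Iso s u := by
  induction h generalizing u with
  | node σ _ ih =>
    cases h' with
    | node τ h' => exact .node (σ.trans τ) fun i => ih i (h' (σ i))

/-- The set of isomorphism classes of (non-planar, nonempty) rooted trees. -/
def RTree : Type := Quotient (⟨PlaneTree.Iso, .refl, .symm, .trans⟩ : Setoid PlaneTree)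

/-- The isomorphism class of a tree. -/
def RTree.mk (t : PlaneTree) : RTree := Quotient.mk _ t

theorem RTree.mk_eq_iff {s t : PlaneTree} : RTree.mk s = RTree.mk t ↔ s.Iso t := Quotient.eq

/-- A representative of an isomorphism class. -/
noncomputable def RTree.out (T : RTree) : PlaneTree := Quotient.out T

theorem RTree.mk_out (T : RTree) : RTree.mk T.out = T := Quotient.out_eq T

/-- The tree obtained by joining the roots of a forest `F` to a new root. -/
noncomputable def RTree.graft (F : Multiset RTree) : RTree :=
  .mk (.node fun i => (F.toList.map RTree.out).get i)

theorem exists_equiv_of_map_eq {α : Type*} {n m : ℕ} (f : Fin n → α) (g : Fin m → α)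
    (h : Finset.univ.val.map f = Finset.univ.val.map g) :
    ∃ σ : Fin n ≃ Fin m, ∀ i, f i = g (σ i) := by
  classical
  have key (a : α) : Nonempty ({i // f i = a} ≃ {j // g j = a}) := by
    refine ⟨Fintype.equivOfCardEq ?_⟩
    have := congrArg (Multiset.count a) h
    rw [Multiset.count_map, Multiset.count_map] at this
    simpa [Fintype.card_subtype, Finset.card_def, eq_comm] using this
  exact ⟨Equiv.ofFiberEquiv fun a => (key a).some, fun i => (Equiv.ofFiberEquiv_map _ i).symm⟩

theorem RTree.mk_node {n : ℕ} (b : Fin n → PlaneTree) :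
    RTree.mk (.node b) = RTree.graft (Finset.univ.val.map fun i => RTree.mk (b i)) := by
  set F := (Finset.univ.val.map fun i => RTree.mk (b i)) with hF
  rw [RTree.graft, mk_eq_iff]
  obtain ⟨σ, h⟩ := exists_equiv_of_map_eq (fun i => RTree.mk (b i))
    (fun i => RTree.mk ((F.toList.map RTree.out).get i)) (by
      rw [← hF, Fin.univ_val_map]
      conv_lhs => rw [← F.coe_toList]
      congr 1
      refine List.ext_getElem (by rw [List.length_ofFn, List.length_map]) fun k h₁ h₂ => ?_
      rw [List.getElem_ofFn, List.get_eq_getElem, List.getElem_map, RTree.mk_out])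
  exact .node σ fun i => mk_eq_iff.1 (h i)

/-- The edges of a rooted tree: the edge from the root to the `i`-th branch, or an edge inside the
`i`-th branch. -/
inductive Edge : PlaneTree → Type
  | base {n : ℕ} {b : Fin n → PlaneTree} (i : Fin n) : Edge (.node b)
  | inside {n : ℕ} {b : Fin n → PlaneTree} (i : Fin n) (e : Edge (b i)) : Edge (.node b)

/-- The edges of a tree, branch by branch. -/
def edgeEquiv {n : ℕ} (b : Fin n → PlaneTree) :
    Edge (.node b) ≃ Σ i : Fin n, Option (Edge (b i)) where
  toFun := fun
    | .base i => ⟨i, none⟩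
    | .inside i e => ⟨i, some e⟩
  invFun := fun
    | ⟨i, none⟩ => .base i
    | ⟨i, some e⟩ => .inside i e
  left_inv e := by cases e <;> rfl
  right_inv e := by rcases e with ⟨i, _ | e⟩ <;> rfl

instance Edge.instFinite (t : PlaneTree) : Finite (Edge t) := by
  induction t with
  | node b ih => exact .of_equiv _ (edgeEquiv b).symm

noncomputable instance (t : PlaneTree) : Fintype (Edge t) := Fintype.ofFinite _

/-- `e.Above e'`: the edges `e ≠ e'` lie on a common path starting at the root, and `e` comes first. -/
inductive Edge.Above : {t : PlaneTree} → Edge t → Edge t → Prop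
  | base {n : ℕ} {b : Fin n → PlaneTree} (i : Fin n) (e : Edge (b i)) :
      Above (.base (b := b) i) (.inside i e)
  | inside {n : ℕ} {b : Fin n → PlaneTree} (i : Fin n) {e e' : Edge (b i)} (h : Above e e') :
      Above (.inside (b := b) i e) (.inside i e')

/-- The tree that hangs at the upper end of an edge, i.e. the tree split off when `e` is removed
(`e` pointing away from the root). -/
def Edge.top : {t : PlaneTree} → Edge t → PlaneTree
  | _, .base (b := b) i => b i
  | _, .inside _ e => e.top

/-- A cut (a set of edges) is admissible if every path from the root to a leaf meets it at most
once. -/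
def Admissible {t : PlaneTree} (c : Finset (Edge t)) : Prop :=
  ∀ e ∈ c, ∀ e' ∈ c, ¬ e.Above e'

open Classical in
/-- The component of the root that remains when the edges of the cut `c` are removed. -/
noncomputable def trunk : (t : PlaneTree) → Set (Edge t) → RTree
  | .node b, c => .graft ((Finset.univ.filter fun i => Edge.base i ∉ c).val.map
      fun i => trunk (b i) {e | Edge.inside i e ∈ c})

theorem trunk_empty (t : PlaneTree) : trunk t ∅ = .mk t := by
  induction t with
  | node b ih => simp [trunk, RTree.mk_node, ih]

/-- The `K`-algebra of rooted trees: the polynomial algebra on the isomorphism classes of rooted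
trees.  (A type synonym, because polynomial rings carry another coalgebra structure.) -/
def HRT (K : Type*) [Field K] : Type _ := MvPolynomial RTree K

section
variable (K : Type*) [Field K]
noncomputable instance : CommRing (HRT K) := inferInstanceAs (CommRing (MvPolynomial RTree K))
noncomputable instance HRT.instAlgebra : Algebra K (HRT K) := inferInstanceAs (Algebra K (MvPolynomial RTree K))

/-- A rooted tree as an element of the algebra. -/
noncomputable def HRT.tree (T : RTree) : HRT K := (MvPolynomial.X T : MvPolynomial RTree K)

/-- The basis of monomials (forests); see `HRT.basis_apply`. -/
noncomputable def HRT.basis : Module.Basis (RTree →₀ ℕ) K (HRT K) := MvPolynomial.basisMonomials RTree K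

/-- The algebra map given by its values on trees. -/
noncomputable def HRT.lift {B : Type*} [CommRing B] [Algebra K B] (f : RTree → B) : HRT K →ₐ[K] B :=
  (MvPolynomial.aeval f : MvPolynomial RTree K →ₐ[K] B)

variable {K}

theorem HRT.lift_tree {B : Type*} [CommRing B] [Algebra K B] (f : RTree → B) (T : RTree) :
    HRT.lift K f (HRT.tree K T) = f T := MvPolynomial.aeval_X f T

theorem HRT.algHom_ext {B : Type*} [CommRing B] [Algebra K B] {f g : HRT K →ₐ[K] B}
    (h : ∀ T, f (HRT.tree K T) = g (HRT.tree K T)) : f = g :=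
  MvPolynomial.algHom_ext (σ := RTree) (R := K) h

theorem HRT.basis_apply (s : RTree →₀ ℕ) :
    HRT.basis K s = (s.toMultiset.map (HRT.tree K)).prod := by
  have : HRT.basis K s = (MvPolynomial.monomial s 1 : MvPolynomial RTree K) :=
    congrFun (MvPolynomial.coe_basisMonomials RTree K) s
  rw [this, MvPolynomial.monomial_eq, map_one, one_mul, Finsupp.prod, Finsupp.toMultiset_apply,
    Finsupp.sum, ← Multiset.coe_mapAddMonoidHom, map_sum, Multiset.prod_sum]
  exact Finset.prod_congr rfl fun T _ => by
    rw [Multiset.coe_mapAddMonoidHom, Multiset.map_nsmul, Multiset.prod_nsmul]; simp; rfl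

open Classical in
theorem HRT.prod_tree (F : Multiset RTree) :
    (F.map (HRT.tree K)).prod = HRT.basis K F.toFinsupp := by
  rw [HRT.basis_apply, Multiset.toFinsupp_toMultiset]

variable (K) in
open Classical in
/-- `Δ(T) = T ⊗ 1 + 1 ⊗ T + ∑ P_c ⊗ R_c`, the sum over the nonempty admissible cuts `c` of `T`;
`P_c` is the product of the trees cut off, `R_c` the tree that contains the root. -/
noncomputable def treeCoproduct (t : PlaneTree) : HRT K ⊗[K] HRT K :=
  HRT.tree K (.mk t) ⊗ₜ 1 + 1 ⊗ₜ HRT.tree K (.mk t) +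
    ∑ c : Finset (Edge t) with Admissible c ∧ c ≠ ∅,
      (∏ e ∈ c, HRT.tree K (.mk e.top)) ⊗ₜ HRT.tree K (trunk t c)

variable (K) in
/-- The linear operator `B⁺` that joins the roots of a forest to a new root. -/
noncomputable def bPlus : HRT K →ₗ[K] HRT K :=
  (HRT.basis K).constr K fun s => HRT.tree K (.graft s.toMultiset)

open Classical in
theorem bPlus_prod (F : Multiset RTree) :
    bPlus K (F.map (HRT.tree K)).prod = HRT.tree K (.graft F) := by
  rw [HRT.prod_tree, bPlus, Module.Basis.constr_basis, Multiset.toFinsupp_toMultiset]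

open Classical in
theorem treeCoproduct_eq (t : PlaneTree) : treeCoproduct K t = HRT.tree K (.mk t) ⊗ₜ 1 +
    ∑ c : {c : Finset (Edge t) // Admissible c},
      (∏ e ∈ c.1, HRT.tree K (.mk e.top)) ⊗ₜ HRT.tree K (trunk t c.1) := by
  rw [treeCoproduct, add_assoc]
  congr 1
  rw [← Finset.sum_subtype (Finset.univ.filter Admissible) (by simp)
    (fun c : Finset (Edge t) => (∏ e ∈ c, HRT.tree K (.mk e.top)) ⊗ₜ[K] HRT.tree K (trunk t c))]
  rw [← Finset.add_sum_erase (Finset.univ.filter Admissible) _ (a := ∅) (by simp [Admissible])]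
  congr 1
  · simp [trunk_empty]
  · refine Finset.sum_congr ?_ fun _ _ => rfl
    ext c; simp [and_comm]

open Classical in
theorem Admissible.inside {n : ℕ} {b : Fin n → PlaneTree} {c : Finset (Edge (.node b))}
    (h : Admissible c) (i : Fin n) : Admissible (t := b i) {e | .inside i e ∈ c} := by
  intro e he e' he' hh
  rw [Finset.mem_filter_univ] at he he'
  exact h _ he _ he' (.inside i hh)

/-- The cut of the whole tree described by a choice, for every branch, of either cutting the branch
off or an admissible cut of it. -/
def glued {n : ℕ} {b : Fin n → PlaneTree}
    (f : ∀ i, Option {c : Finset (Edge (b i)) // Admissible c}) : Edge (.node b) → Prop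
  | .base i => f i = none
  | .inside i e => ∃ d, f i = some d ∧ e ∈ d.1

open Classical in
/-- An admissible cut either cuts off a given branch or restricts to an admissible cut of it. -/
noncomputable def admEquiv {n : ℕ} (b : Fin n → PlaneTree) :
    {c : Finset (Edge (.node b)) // Admissible c} ≃
      ∀ i, Option {c : Finset (Edge (b i)) // Admissible c} where
  toFun c i := if .base i ∈ c.1 then none else some ⟨_, c.2.inside i⟩
  invFun f := ⟨Finset.univ.filter (glued f), by
      intro e he e' he' h
      rw [Finset.mem_filter_univ] at he he'
      cases h with
      | base i e =>
        obtain ⟨d, hd, -⟩ := he'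
        exact absurd (he.symm.trans hd) (by simp)
      | inside i h =>
        obtain ⟨d, hd, h2⟩ := he
        obtain ⟨d', hd', h2'⟩ := he'
        obtain rfl := Option.some.inj (hd.symm.trans hd')
        exact d.2 _ h2 _ h2' h⟩
  left_inv c := by
    apply Subtype.ext
    ext e
    cases e with
    | base i => simp [glued]
    | inside i e =>
      by_cases h : Edge.base i ∈ c.1
      · simp [h, glued]
        exact fun h' => c.2 _ h _ h' (.base i e)
      · simp [h, glued]
  right_inv f := by
    funext i
    cases h : f i with
    | none => simp [h, glued]
    | some d => simp [h, glued]

theorem prod_tmul {ι : Type*} (s : Finset ι) (f g : ι → HRT K) :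
    ∏ i ∈ s, (f i ⊗ₜ[K] g i) = (∏ i ∈ s, f i) ⊗ₜ[K] (∏ i ∈ s, g i) := by
  classical
  induction s using Finset.induction_on with
  | empty => simp [Algebra.TensorProduct.one_def]
  | insert i s hi ih => simp [Finset.prod_insert hi, ih]

theorem treeCoproduct_node {n : ℕ} (b : Fin n → PlaneTree) :
    treeCoproduct K (.node b) = HRT.tree K (.mk (.node b)) ⊗ₜ 1 +
      (bPlus K).lTensor (HRT K) (∏ i, treeCoproduct K (b i)) := by
  classical
  rw [treeCoproduct_eq]
  congr 1
  simp_rw [treeCoproduct_eq]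
  have : ∀ i, HRT.tree K (.mk (b i)) ⊗ₜ[K] (1 : HRT K) +
    ∑ c : {c : Finset (Edge (b i)) // Admissible c},
      (∏ e ∈ c.1, HRT.tree K (.mk e.top)) ⊗ₜ[K] HRT.tree K (trunk (b i) c.1) = 
      ∑ o : Option {c : Finset (Edge (b i)) // Admissible c},
       (o.elim (HRT.tree K (.mk (b i))) fun c => ∏ e ∈ c.1, HRT.tree K (.mk e.top)) ⊗ₜ[K] 
       (o.elim 1 fun c => HRT.tree K (trunk (b i) c.1)) := by
    intro i
    rw [Fintype.sum_option]; rfl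
  simp_rw [this]
  rw [Finset.prod_univ_sum, Fintype.piFinset_univ, map_sum]
  refine Fintype.sum_equiv (admEquiv b) _ _ fun c => ?_
  rw [prod_tmul, LinearMap.lTensor_tmul]
  congr 1
  · have key (i : Fin n) : (((admEquiv b) c i).elim (HRT.tree K (.mk (b i)))
          fun c => ∏ e ∈ c.1, HRT.tree K (.mk e.top)) =
        ∏ o : Option (Edge (b i)), if (edgeEquiv b).symm ⟨i, o⟩ ∈ c.1 then
          HRT.tree K (.mk ((edgeEquiv b).symm ⟨i, o⟩).top) else 1 := by
      rw [Fintype.prod_option]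
      by_cases h : Edge.base i ∈ c.1
      · have h' (e : Edge (b i)) : Edge.inside i e ∉ c.1 := fun h' => c.2 _ h _ h' (.base i e)
        simp [admEquiv, h, h', edgeEquiv, Edge.top]
      · simp [admEquiv, h, edgeEquiv, Edge.top, Finset.prod_filter]
    simp_rw [key]
    rw [← Fintype.prod_sigma', ← Equiv.prod_comp (edgeEquiv b).symm.symm]
    simp
  · have key (i : Fin n) : (((admEquiv b) c i).elim 1 fun c => HRT.tree K (trunk (b i) c.1)) =
        if .base i ∉ c.1 then HRT.tree K (trunk (b i) {e | .inside i e ∈ c.1}) else 1 := by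
      by_cases h : .base i ∈ c.1 <;> simp [admEquiv, h]
    simp_rw [key]
    rw [← Finset.prod_filter, trunk, ← bPlus_prod, Multiset.map_map, Finset.prod]
    simp only [Finset.mem_coe]
    congr!

theorem treeCoproduct_eq_of_iso {s t : PlaneTree} (h : s.Iso t) :
    treeCoproduct K s = treeCoproduct K t := by
  induction h with
  | node σ h ih =>
    rename_i b'
    rw [treeCoproduct_node, treeCoproduct_node, RTree.mk_eq_iff.2 (.node σ h)]
    simp_rw [ih]
    rw [Equiv.prod_comp σ (fun i => treeCoproduct K (b' i))]

variable (K) in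
/-- The coproduct: the algebra map given on trees by admissible cuts. -/
noncomputable def HRT.comul : HRT K →ₐ[K] HRT K ⊗[K] HRT K :=
  HRT.lift K fun T => T.liftOn (treeCoproduct K) fun _ _ => treeCoproduct_eq_of_iso

variable (K) in
/-- The counit: the algebra map that kills every tree. -/
noncomputable def HRT.counit : HRT K →ₐ[K] K := HRT.lift K fun _ => 0

theorem HRT.comul_mk (t : PlaneTree) : HRT.comul K (HRT.tree K (.mk t)) = treeCoproduct K t :=
  HRT.lift_tree _ _

theorem HRT.counit_bPlus (x : HRT K) : HRT.counit K (bPlus K x) = 0 := by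
  suffices h : (HRT.counit K).toLinearMap ∘ₗ bPlus K = 0 from LinearMap.congr_fun h x
  refine (HRT.basis K).ext fun s => ?_
  simp [bPlus, HRT.counit, HRT.lift_tree]

theorem HRT.exists_node (F : Multiset RTree) : ∃ (n : ℕ) (b : Fin n → PlaneTree),
    Finset.univ.val.map (fun i => RTree.mk (b i)) = F := by
  refine ⟨F.toList.length, fun i => (F.toList.get i).out, ?_⟩
  simp_rw [RTree.mk_out]
  rw [Fin.univ_val_map, List.ofFn_get, Multiset.coe_toList]

theorem HRT.comul_bPlus (x : HRT K) : HRT.comul K (bPlus K x) =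
    bPlus K x ⊗ₜ 1 + (bPlus K).lTensor (HRT K) (HRT.comul K x) := by
  suffices h : (HRT.comul K).toLinearMap ∘ₗ bPlus K =
      (TensorProduct.mk K (HRT K) (HRT K)).flip 1 ∘ₗ bPlus K +
        (bPlus K).lTensor (HRT K) ∘ₗ (HRT.comul K).toLinearMap from LinearMap.congr_fun h x
  refine (HRT.basis K).ext fun s => ?_
  obtain ⟨n, b, hb⟩ := HRT.exists_node s.toMultiset
  have h1 : HRT.basis K s = ∏ i, HRT.tree K (.mk (b i)) := by
    rw [HRT.basis_apply, ← hb, Multiset.map_map]; rfl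
  have h2 : bPlus K (HRT.basis K s) = HRT.tree K (.mk (.node b)) := by
    rw [HRT.basis_apply, bPlus_prod, RTree.mk_node, hb]
  simp only [LinearMap.comp_apply, LinearMap.add_apply, h2, AlgHom.toLinearMap_apply, HRT.comul_mk,
    treeCoproduct_node]
  have h3 : HRT.comul K (HRT.basis K s) = ∏ i, treeCoproduct K (b i) := by
    rw [h1, map_prod]
    exact Finset.prod_congr rfl fun i _ => HRT.comul_mk _
  rw [h3]
  rfl

theorem HRT.hom_ext_of_bPlus {B : Type*} [CommRing B] [Algebra K B] (f g : HRT K →ₐ[K] B)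
    (h : ∀ x, f x = g x → f (bPlus K x) = g (bPlus K x)) : f = g := by
  refine HRT.algHom_ext fun T => ?_
  rw [← T.mk_out]
  induction T.out with
  | node b ih =>
    rw [RTree.mk_node, ← bPlus_prod]
    apply h
    rw [Multiset.map_map]
    change f (∏ i, _) = g (∏ i, _)
    rw [map_prod, map_prod]
    exact Finset.prod_congr rfl fun i _ => ih i

variable (K) in
/-- The bialgebra of rooted trees. -/
noncomputable instance HRT.instBialgebra : Bialgebra K (HRT K) :=
  Bialgebra.ofAlgHom (HRT.comul K) (HRT.counit K)
    (by
      refine HRT.hom_ext_of_bPlus _ _ fun x hx => ?_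
      have h1 (y : HRT K ⊗[K] HRT K) :
          Algebra.TensorProduct.assoc K K K _ _ _ (Algebra.TensorProduct.map (HRT.comul K)
            (.id K (HRT K)) ((bPlus K).lTensor (HRT K) y)) =
          ((bPlus K).lTensor (HRT K)).lTensor (HRT K) (Algebra.TensorProduct.assoc K K K _ _ _
            (Algebra.TensorProduct.map (HRT.comul K) (.id K (HRT K)) y)) := by
        induction y with
        | zero => simp
        | add y z hy hz => simp only [map_add, hy, hz]
        | tmul a b =>
          simp only [LinearMap.lTensor_tmul, Algebra.TensorProduct.map_tmul, AlgHom.id_apply]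
          induction HRT.comul K a with
          | zero => simp
          | add y z hy hz => simp only [TensorProduct.add_tmul, map_add, hy, hz]
          | tmul c d => simp
      have h2 (y : HRT K ⊗[K] HRT K) :
          Algebra.TensorProduct.map (.id K (HRT K)) (HRT.comul K) ((bPlus K).lTensor (HRT K) y) =
            Algebra.TensorProduct.assoc K K K _ _ _ ((bPlus K).lTensor (HRT K) y ⊗ₜ (1 : HRT K)) +
            ((bPlus K).lTensor (HRT K)).lTensor (HRT K)
              (Algebra.TensorProduct.map (.id K (HRT K)) (HRT.comul K) y) := by
        induction y with
        | zero => simp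
        | add y z hy hz =>
          simp only [map_add, hy, hz, TensorProduct.add_tmul]
          abel
        | tmul a b => simp [HRT.comul_bPlus, TensorProduct.tmul_add]
      replace hx : Algebra.TensorProduct.assoc K K K _ _ _ (Algebra.TensorProduct.map
          (HRT.comul K) (.id K (HRT K)) (HRT.comul K x)) =
        Algebra.TensorProduct.map (.id K (HRT K)) (HRT.comul K) (HRT.comul K x) := hx
      change Algebra.TensorProduct.assoc K K K _ _ _ (Algebra.TensorProduct.map
          (HRT.comul K) (.id K (HRT K)) (HRT.comul K (bPlus K x))) =
        Algebra.TensorProduct.map (.id K (HRT K)) (HRT.comul K) (HRT.comul K (bPlus K x))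
      rw [HRT.comul_bPlus, map_add, map_add, map_add, h1, h2, hx, ← add_assoc]
      congr 1
      simp [HRT.comul_bPlus, TensorProduct.add_tmul, Algebra.TensorProduct.one_def])
    (by
      refine HRT.hom_ext_of_bPlus _ _ fun x hx => ?_
      have h (y : HRT K ⊗[K] HRT K) :
          Algebra.TensorProduct.map (HRT.counit K) (.id K (HRT K)) ((bPlus K).lTensor (HRT K) y) =
          (bPlus K).lTensor K (Algebra.TensorProduct.map (HRT.counit K) (.id K (HRT K)) y) := by
        induction y with
        | zero => simp
        | add y z hy hz => simp only [map_add, hy, hz]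
        | tmul a b => simp
      replace hx : Algebra.TensorProduct.map (HRT.counit K) (.id K (HRT K)) (HRT.comul K x) =
        1 ⊗ₜ x := hx
      change Algebra.TensorProduct.map (HRT.counit K) (.id K (HRT K)) (HRT.comul K (bPlus K x)) =
        1 ⊗ₜ bPlus K x
      rw [HRT.comul_bPlus, map_add, h, hx]
      simp [HRT.counit_bPlus])
    (by
      refine HRT.hom_ext_of_bPlus _ _ fun x _ => ?_
      have h (y : HRT K ⊗[K] HRT K) :
          Algebra.TensorProduct.map (.id K (HRT K)) (HRT.counit K)
            ((bPlus K).lTensor (HRT K) y) = 0 := by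
        induction y with
        | zero => simp
        | add y z hy hz => simp only [map_add, hy, hz, add_zero]
        | tmul a b => simp [HRT.counit_bPlus]
      change Algebra.TensorProduct.map (.id K (HRT K)) (HRT.counit K) (HRT.comul K (bPlus K x)) =
        bPlus K x ⊗ₜ 1
      rw [HRT.comul_bPlus, map_add, h]
      simp)
end

section
variable {K A : Type*} [Field K] [CommRing A] [Algebra K A]

/-- Rota-Baxter maps of weight `θ`. -/
def IsRotaBaxter (θ : K) (R : A →ₗ[K] A) : Prop :=
  ∀ x y : A, R x * R y + θ • R (x * y) = R (R x * y + x * R y)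

variable (K A) in
/-- The linear maps from the bialgebra of rooted trees to `A`.  `WithConv` makes multiplication the
convolution product `f * g = m_A ∘ (f ⊗ g) ∘ Δ`, with unit `x ↦ ε(x) 1`; brackets
are commutators for it. -/
abbrev Conv : Type _ := WithConv (HRT K →ₗ[K] A)

/-- Infinitesimal characters (derivations) with values in `A`. -/
def IsInfChar (Z : Conv K A) : Prop :=
  ∀ x y : HRT K, Z (x * y) = HRT.counit K y • Z x + HRT.counit K x • Z y

/-- The map `f ↦ P ∘ f` on linear maps induced by a linear map `P : A → A`. -/
noncomputable def post (P : A →ₗ[K] A) (f : Conv K A) : Conv K A := .toConv (P ∘ₗ f.ofConv)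

/-- On every element only finitely many terms of the sequence are nonzero. -/
def PointwiseFinite (f : ℕ → Conv K A) : Prop := ∀ x : HRT K, {k | f k x ≠ 0}.Finite

/-- The sum of a pointwise finite series: the linear map with value `∑ k, f k s` at each
forest `s`. -/
noncomputable def seriesSum (f : ℕ → Conv K A) : Conv K A :=
  .toConv ((HRT.basis K).constr K fun s => ∑ᶠ k, f k (HRT.basis K s))

/-- The `k`-th term of the convolution exponential. -/
noncomputable def expTerm (Z : Conv K A) (k : ℕ) : Conv K A := (k.factorial : K)⁻¹ • Z ^ k

/-- The convolution exponential. -/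
noncomputable def expStar (Z : Conv K A) : Conv K A := seriesSum (expTerm Z)

variable (K) in
open Classical in
/-- The homogeneous terms of the full Baker-Campbell-Hausdorff Lie series `log (exp x exp y)`, as
nested commutators: `z 0 = 0`, `z 1 = x + y`, and
`(n + 1) z (n + 1) = 1/2 [x - y, z n] + ∑ B (2p) / (2p)! [z k₁, [z k₂, ⋯ [z k₂ₚ, x + y] ⋯ ]]`,
where `B` denotes the Bernoulli numbers and the sum runs over all compositions of `n` into an even
number `2p` of positive parts `k₁, …, k₂ₚ` (for `n = 0` this is the empty composition, which
contributes `x + y`).  Thus `z 2 = 1/2 [x, y]` and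
`z 3 = 1/12 ([x, [x, y]] - [y, [x, y]])`. -/
noncomputable def bchTerm {L : Type*} [Ring L] [Algebra K L] (x y : L) : ℕ → L
  | 0 => 0
  | n + 1 => ((n + 1 : ℕ) : K)⁻¹ • ((2 : K)⁻¹ • ⁅x - y, bchTerm x y n⁆ +
      ∑ c : Composition n with Even c.length, ((bernoulli c.length / c.length.factorial : ℚ) : K) •
        (List.finRange c.length).foldr (fun i w => ⁅bchTerm x y (c.blocksFun i), w⁆) (x + y))
  termination_by n => n
  decreasing_by
  · exact Nat.lt_succ_self _
  · exact Nat.lt_succ_of_le (c.blocksFun_le i)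

/-- The term `c_k K^(k)(x, y)` of the series `BCH(x, y) = ∑_{k ≥ 1} c_k K^(k)(x, y)`, built
from commutators of depth `k`, i.e. homogeneous of degree `k + 1` in `x, y`. -/
noncomputable def bchDepth {L : Type*} [Ring L] [Algebra K L] (x y : L) (k : ℕ) : L :=
  bchTerm K x y (k + 1)

/-- `BCH(x, y) = 1/2 [x, y] + 1/12 ([x, [x, y]] - [y, [x, y]]) + ⋯`, the sum over depths
`k + 1 ≥ 1`. -/
noncomputable def bch (x y : Conv K A) : Conv K A := seriesSum fun k => bchDepth (K := K) x y (k + 1)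

/-- `P` applied to every coefficient of a power series in `u`. -/
noncomputable def postSeries (P : A →ₗ[K] A) (χ : PowerSeries (Conv K A)) :
    PowerSeries (Conv K A) :=
  PowerSeries.mk fun n => post P (PowerSeries.coeff n χ)

/-- The fixed point equation
`χ(u) = Z - ∑_{k ≥ 1} u ^ k c_k K^(k)(R(χ(u)), (id - R)(χ(u)))` for a formal power series `χ(u)`
in `u`.  Terms with `k > n` do not contribute to the coefficient of `u ^ n`. -/
def IsChiSeries (R : A →ₗ[K] A) (Z : Conv K A) (χ : PowerSeries (Conv K A)) : Prop :=
  ∀ n : ℕ, PowerSeries.coeff n χ = PowerSeries.coeff n (PowerSeries.C Z -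
    ∑ k ∈ Finset.Icc 1 n, PowerSeries.X ^ k *
      bchDepth (K := K) (postSeries R χ) (postSeries (LinearMap.id - R) χ) k)

/-- The value at `u = 1` of a power series in `u`. -/
noncomputable def evalOne (χ : PowerSeries (Conv K A)) : Conv K A :=
  seriesSum fun n => PowerSeries.coeff n χ

end

end CK

/-! Everything is controlled by the decreasing filtration `vanishing K A N` of maps that kill all
forests with fewer than N vertices. The coproduct does not increase the total number of vertices, so
the filtration is multiplicative (`vanishing_mul`). It is separated, and infinitesimal characters
lie in step 1. A Lie polynomial homogeneous of degree n in them therefore lies in step n, and all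
the series converge.

The BCH formula `expStar_mul_expStar` is proved modulo each `vanishing K A (N + 1)`, where step 1
becomes nilpotent. There the recursion for `bchTerm` says that z(t) = ∑ t^n z_n solves z' = 1/2 [x -
y, z] + ∑ B_{2p}/(2p)! ad_z^{2p}(x + y). By the derivative formula for exp (`leibniz_exp`), e^{z(t)}
solves F' = xF + Fy with F(0) = 1. So does e^{tx} e^{ty}; hence the two agree, and t = 1 gives the
formula.

The factor u^k with k ≥ 1 turns the equation for χ(u) into a recursion on coefficients. Brackets of
infinitesimal characters are infinitesimal characters (`infChar_lie`), and the coefficient of u^n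
lies in step n + 1 (`IsChiSeries.coeff_mem`), so the value at u = 1 exists and solves the fixed
point equation (`IsChiSeries.isSum`). Since BCH starts in degree 2, it is a contraction for the
filtration (`bch_sub_mem`), which gives uniqueness. With x = Rχ and y = χ - Rχ, the exponent x + y +
BCH(x, y) is Z, which is the factorization. -/

namespace CK

open scoped TensorProduct

/-! ### Exponentials of nilpotent elements and the BCH differential equation -/

section NilpotentExp

variable {S : Type*} [Ring S] [Algebra ℚ S]

/-- The operator `b ↦ a * b - b * a`. -/
def adj (a : S) : Module.End ℚ S := LinearMap.mulLeft ℚ a - LinearMap.mulRight ℚ a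

theorem adj_apply (a b : S) : adj a b = a * b - b * a := rfl

theorem isNilpotent_adj {a : S} (ha : IsNilpotent a) : IsNilpotent (adj a) := by
  have hl : IsNilpotent (LinearMap.mulLeft ℚ a) := by rwa [LinearMap.isNilpotent_mulLeft_iff]
  have hr : IsNilpotent (LinearMap.mulRight ℚ a) := by rwa [LinearMap.isNilpotent_mulRight_iff]
  exact (LinearMap.commute_mulLeft_right a a).isNilpotent_sub hl hr

theorem exp_mulLeft {a : S} (ha : IsNilpotent a) :
    IsNilpotent.exp (LinearMap.mulLeft ℚ a) = LinearMap.mulLeft ℚ (IsNilpotent.exp a) := by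
  obtain ⟨k, hk⟩ := ha
  have hk' : LinearMap.mulLeft ℚ a ^ k = 0 := by rw [LinearMap.pow_mulLeft, hk]; ext; simp
  rw [IsNilpotent.exp_eq_sum hk, IsNilpotent.exp_eq_sum hk']
  ext b
  simp [LinearMap.pow_mulLeft, Finset.sum_mul]

theorem exp_mulRight {a : S} (ha : IsNilpotent a) :
    IsNilpotent.exp (LinearMap.mulRight ℚ a) = LinearMap.mulRight ℚ (IsNilpotent.exp a) := by
  obtain ⟨k, hk⟩ := ha
  have hk' : LinearMap.mulRight ℚ a ^ k = 0 := by rw [LinearMap.pow_mulRight, hk]; ext; simp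
  rw [IsNilpotent.exp_eq_sum hk, IsNilpotent.exp_eq_sum hk']
  ext b
  simp [LinearMap.pow_mulRight, Finset.mul_sum]

/-- `adj a` is the sum of left multiplication by `a` and right multiplication by `-a`; these
commute, so the exponential factors. -/
theorem exp_adj {a : S} (ha : IsNilpotent a) (b : S) :
    IsNilpotent.exp (adj a) b = IsNilpotent.exp a * b * IsNilpotent.exp (-a) := by
  have hl : IsNilpotent (LinearMap.mulLeft ℚ a) := by rwa [LinearMap.isNilpotent_mulLeft_iff]
  have hr : IsNilpotent (LinearMap.mulRight ℚ (-a)) := by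
    rw [LinearMap.isNilpotent_mulRight_iff]; exact ha.neg
  have h : adj a = LinearMap.mulLeft ℚ a + LinearMap.mulRight ℚ (-a) := by
    ext b; simp [adj_apply, sub_eq_add_neg]
  rw [h, IsNilpotent.exp_add_of_commute (LinearMap.commute_mulLeft_right _ _) hl hr,
    exp_mulLeft ha, exp_mulRight ha.neg]
  simp [mul_assoc]

/-- The Leibniz rule gives [L_z, D] = -L_{Dz}, where L denotes left multiplication; further brackets
with L_z stay among left multiplications. -/
theorem adj_mulLeft_pow_succ (D : Module.End ℚ S) (hD : ∀ x y, D (x * y) = D x * y + x * D y)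
    (z : S) (k : ℕ) : (adj (LinearMap.mulLeft ℚ z) ^ (k + 1)) D =
      -LinearMap.mulLeft ℚ ((adj z ^ k) (D z)) := by
  induction k with
  | zero => ext b; simp [adj_apply, hD]
  | succ k ih =>
    rw [pow_succ', Module.End.mul_apply, ih, pow_succ' (adj z), Module.End.mul_apply]
    ext b
    simp only [adj_apply, Module.End.mul_apply, LinearMap.neg_apply, LinearMap.sub_apply,
      LinearMap.mulLeft_apply, sub_mul, mul_assoc, mul_neg]
    abel

/-- The derivative of the exponential map. -/
theorem leibniz_exp (D : Module.End ℚ S) (hD : ∀ x y, D (x * y) = D x * y + x * D y)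
    {z : S} (hz : IsNilpotent z) {M : ℕ} (hM : (adj z ^ M) (D z) = 0) :
    D (IsNilpotent.exp z) =
      (∑ k ∈ Finset.range M, ((k + 1).factorial : ℚ)⁻¹ • (adj z ^ k) (D z)) *
        IsNilpotent.exp z := by
  have hl : IsNilpotent (LinearMap.mulLeft ℚ z) := by rwa [LinearMap.isNilpotent_mulLeft_iff]
  -- Two expressions for exp(ad L_z) D are applied to e^z. As the conjugate e^z D e^{-z} it gives
  -- e^z D(1) = 0; as a series it gives D(e^z) minus the right-hand side of the goal.
  have h1 := exp_adj hl D
  have h2 := IsNilpotent.exp_smul_eq_sum (a := adj (LinearMap.mulLeft ℚ z)) (m := D) (k := M + 1)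
    (by
      change (adj (LinearMap.mulLeft ℚ z) ^ (M + 1)) D = 0
      rw [adj_mulLeft_pow_succ D hD, hM]; ext; simp) (isNilpotent_adj hl)
  have h3 := LinearMap.congr_fun (h1.symm.trans h2) (IsNilpotent.exp z)
  have h4 : -LinearMap.mulLeft ℚ z = LinearMap.mulLeft ℚ (-z) := by ext; simp
  have h5 : D 1 = 0 := by simpa using hD 1 1
  rw [h4, exp_mulLeft hz, exp_mulLeft hz.neg] at h3
  simp only [Module.End.mul_apply, LinearMap.mulLeft_apply, IsNilpotent.exp_neg_mul_exp_self hz,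
    h5, mul_zero] at h3
  rw [Finset.sum_range_succ'] at h3
  simp only [Module.End.smul_def, adj_mulLeft_pow_succ D hD] at h3
  simp only [smul_neg, Finset.sum_neg_distrib, pow_zero, Nat.factorial_zero, Nat.cast_one, inv_one,
    one_smul, LinearMap.add_apply, LinearMap.neg_apply, Module.End.one_apply] at h3
  rw [Finset.sum_mul, ← sub_eq_zero, ← neg_add_eq_sub]
  rw [h3]
  congr 2
  simp

/-- The value of a power series at an element whose `M`-th power vanishes. -/
noncomputable def nilEval (M : ℕ) (f : PowerSeries ℚ) (T : S) : S :=
  ∑ k ∈ Finset.range M, PowerSeries.coeff k f • T ^ k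

theorem aeval_trunc (M : ℕ) (f : PowerSeries ℚ) (T : S) :
    Polynomial.aeval T (PowerSeries.trunc M f) = nilEval M f T := by
  rw [PowerSeries.trunc_apply, map_sum, nilEval, Nat.Ico_zero_eq_range]
  refine Finset.sum_congr rfl fun k _ => ?_
  rw [Polynomial.aeval_monomial, Algebra.smul_def]

theorem nilEval_coe {M : ℕ} {T : S} (hT : T ^ M = 0) (p : Polynomial ℚ) :
    nilEval M (p : PowerSeries ℚ) T = Polynomial.aeval T p := by
  rw [Polynomial.aeval_eq_sum_range' (n := M + p.natDegree + 1) (by omega), nilEval]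
  simp only [Polynomial.coeff_coe]
  refine Finset.sum_subset (by intro; simp; omega) fun k _ hk => ?_
  rw [pow_eq_zero_of_le (by simpa using hk) hT, smul_zero]

/-- Coefficients from degree M on are invisible because T^M = 0, so both sides can be computed with
truncations, and polynomial evaluation is multiplicative. -/
theorem nilEval_mul {M : ℕ} {T : S} (hT : T ^ M = 0) (f g : PowerSeries ℚ) :
    nilEval M (f * g) T = nilEval M f T * nilEval M g T := by
  rw [← aeval_trunc, ← PowerSeries.trunc_trunc_mul_trunc, aeval_trunc, ← Polynomial.coe_mul,
    nilEval_coe hT, map_mul, aeval_trunc, aeval_trunc]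

theorem nilEval_add (M : ℕ) (T : S) (f g : PowerSeries ℚ) :
    nilEval M (f + g) T = nilEval M f T + nilEval M g T := by
  simp [nilEval, add_smul, Finset.sum_add_distrib]

theorem nilEval_sub (M : ℕ) (T : S) (f g : PowerSeries ℚ) :
    nilEval M (f - g) T = nilEval M f T - nilEval M g T := by
  simp [nilEval, sub_smul, Finset.sum_sub_distrib]

theorem nilEval_one {M : ℕ} {T : S} (hT : T ^ M = 0) : nilEval M 1 T = 1 := by
  simpa using nilEval_coe hT 1

theorem nilEval_X {M : ℕ} {T : S} (hT : T ^ M = 0) : nilEval M PowerSeries.X T = T := by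
  simpa using nilEval_coe hT Polynomial.X

theorem nilEval_exp {M : ℕ} {T : S} (hT : T ^ M = 0) :
    nilEval M (PowerSeries.exp ℚ) T = IsNilpotent.exp T := by
  rw [IsNilpotent.exp_eq_sum hT, nilEval]
  simp [PowerSeries.coeff_exp]

/-- The power series `(exp X - 1) / X`. -/
noncomputable def expSubOneDiv : PowerSeries ℚ :=
  PowerSeries.mk fun k => ((k + 1).factorial : ℚ)⁻¹

/-- The even part `∑ B (2p) / (2p)! X ^ (2p)` of the Bernoulli series. -/
noncomputable def evenBernoulli : PowerSeries ℚ :=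
  PowerSeries.mk fun k => if Even k then bernoulli k / k.factorial else 0

theorem expSubOneDiv_mul_X : expSubOneDiv * PowerSeries.X = PowerSeries.exp ℚ - 1 := by
  ext k
  cases k with
  | zero => simp
  | succ k =>
    simp [PowerSeries.coeff_succ_mul_X, expSubOneDiv, PowerSeries.coeff_exp, PowerSeries.coeff_one]

theorem expSubOneDiv_mul_bernoulli : expSubOneDiv * bernoulliPowerSeries ℚ = 1 := by
  have h := bernoulliPowerSeries_mul_exp_sub_one ℚ
  rw [← expSubOneDiv_mul_X, ← mul_assoc] at h
  have h' : PowerSeries.X * (expSubOneDiv * bernoulliPowerSeries ℚ - 1) = 0 := by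
    linear_combination h
  rcases mul_eq_zero.1 h' with h' | h'
  · exact absurd h' PowerSeries.X_ne_zero
  · exact sub_eq_zero.1 h'

/-- The only nonzero odd Bernoulli number is B_1 = -1/2, and X/2 cancels its term. -/
theorem evenBernoulli_eq :
    evenBernoulli = bernoulliPowerSeries ℚ + (2 : ℚ)⁻¹ • PowerSeries.X := by
  ext k
  rw [evenBernoulli, bernoulliPowerSeries, map_add, PowerSeries.coeff_mk, PowerSeries.coeff_mk,
    PowerSeries.coeff_smul, PowerSeries.coeff_X]
  by_cases hk : Even k
  · rw [if_pos hk, if_neg (by rintro rfl; simp at hk)]; simp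
  · rw [if_neg hk]
    rw [Nat.not_even_iff_odd] at hk
    by_cases h1 : k = 1
    · subst h1; norm_num [bernoulli_one]
    · rw [bernoulli_eq_zero_of_odd hk (by have := hk.pos; omega), if_neg h1]; simp

/-- The exponential of a solution of the Baker-Campbell-Hausdorff differential equation. -/
theorem leibniz_exp_of_bch_ode (D : Module.End ℚ S) (hD : ∀ x y, D (x * y) = D x * y + x * D y)
    {x y z : S} (hz : IsNilpotent z) {M : ℕ} (hM : adj z ^ M = 0)
    (h : D z = (2 : ℚ)⁻¹ • ((x - y) * z - z * (x - y)) +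
      nilEval M evenBernoulli (adj z) (x + y)) :
    D (IsNilpotent.exp z) = x * IsNilpotent.exp z + IsNilpotent.exp z * y := by
  -- The X/2 separating the even part from the full Bernoulli series combines with the bracket: 1/2
  -- [x - y, z] + 1/2 [z, x + y] = [z, y].
  have h1 : D z = nilEval M (bernoulliPowerSeries ℚ) (adj z) (x + y) + adj z y := by
    rw [h, evenBernoulli_eq, nilEval_add]
    have : nilEval M ((2 : ℚ)⁻¹ • PowerSeries.X) (adj z) = (2 : ℚ)⁻¹ • adj z := by
      conv_rhs => rw [← nilEval_X hM]
      simp only [nilEval, Finset.smul_sum, PowerSeries.coeff_smul, smul_smul, smul_eq_mul]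
    rw [this, LinearMap.add_apply, LinearMap.smul_apply]
    simp only [adj_apply, mul_add, add_mul, mul_sub, sub_mul]
    module
  have h2 : (∑ k ∈ Finset.range M, ((k + 1).factorial : ℚ)⁻¹ • (adj z ^ k) (D z)) =
      nilEval M expSubOneDiv (adj z) (D z) := by
    simp [nilEval, expSubOneDiv, LinearMap.sum_apply]
  rw [leibniz_exp D hD hz (M := M) (by rw [hM]; rfl), h2, h1, map_add]
  -- Applying (e^X - 1)/X at ad z returns x + y from the Bernoulli part and turns [z, y] into (e^{ad
  -- z} - 1) y = e^z y e^{-z} - y; the total is x + e^z y e^{-z}.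
  rw [← Module.End.mul_apply, ← nilEval_mul hM, expSubOneDiv_mul_bernoulli, nilEval_one hM]
  conv_lhs => enter [1, 2, 2, 1]; rw [← nilEval_X hM]
  rw [← Module.End.mul_apply, ← nilEval_mul hM, expSubOneDiv_mul_X, nilEval_sub, nilEval_one hM,
    nilEval_exp hM, LinearMap.sub_apply, exp_adj hz]
  simp only [Module.End.one_apply, add_mul, sub_mul, mul_assoc, IsNilpotent.exp_neg_mul_exp_self hz]
  simp

end NilpotentExp

/-! ### Sums over compositions as coefficients of iterated commutators -/

section Compositions

theorem sum_antidiagonalTuple_succ {M : Type*} [AddCommMonoid M] (m n : ℕ)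
    (f : (Fin (m + 1) → ℕ) → M) :
    ∑ x ∈ Finset.Nat.antidiagonalTuple (m + 1) n, f x =
      ∑ p ∈ Finset.HasAntidiagonal.antidiagonal n, ∑ x ∈ Finset.Nat.antidiagonalTuple m p.2, f (Fin.cons p.1 x) := by
  rw [Finset.sum_sigma']
  symm
  refine Finset.sum_bij (fun q _ => Fin.cons q.1.1 q.2) ?_ ?_ ?_ fun _ _ => rfl
  · rintro ⟨⟨i, j⟩, x⟩ h
    simp only [Finset.mem_sigma, Finset.HasAntidiagonal.mem_antidiagonal, Finset.Nat.mem_antidiagonalTuple] at h ⊢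
    rw [Fin.sum_cons, h.2, h.1]
  · rintro ⟨⟨i, j⟩, x⟩ h ⟨⟨i', j'⟩, x'⟩ h' hh
    simp only [Finset.mem_sigma, Finset.HasAntidiagonal.mem_antidiagonal, Finset.Nat.mem_antidiagonalTuple] at h h'
    obtain ⟨h1, h2⟩ := Fin.cons_injective2 hh
    dsimp only at h1 h2 h h'
    subst h1 h2
    obtain rfl : j = j' := by omega
    rfl
  · intro x hx
    rw [Finset.Nat.mem_antidiagonalTuple, Fin.sum_univ_succ] at hx
    refine ⟨⟨(x 0, ∑ i : Fin m, x i.succ), Fin.tail x⟩, ?_, Fin.cons_self_tail x⟩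
    simp [Finset.Nat.mem_antidiagonalTuple, hx, Fin.tail]

variable {S : Type*} [Ring S]

/-- The nested commutator `[g k₁, [g k₂, ⋯ [g kₘ, w] ⋯ ]]`. -/
def nestedLie (g : ℕ → S) (w : S) (l : List ℕ) : S := l.foldr (fun k v => ⁅g k, v⁆) w

theorem foldr_blocksFun (g : ℕ → S) (w : S) {n : ℕ} (c : Composition n) :
    (List.finRange c.length).foldr (fun i v => ⁅g (c.blocksFun i), v⁆) w =
      nestedLie g w c.blocks := by
  conv_rhs => rw [nestedLie, ← c.ofFn_blocksFun, List.ofFn_eq_map, List.foldr_map]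

theorem nestedLie_eq_zero {g : ℕ → S} (hg : g 0 = 0) (w : S) {l : List ℕ} (hl : 0 ∈ l) :
    nestedLie g w l = 0 := by
  induction l with
  | nil => simp at hl
  | cons k l ih =>
    simp only [nestedLie, List.foldr_cons] at ih ⊢
    rcases List.mem_cons.1 hl with rfl | hl
    · simp [hg, Ring.lie_def]
    · rw [ih hl]; simp [Ring.lie_def]

/-- Tuples with a zero entry contribute nothing because g 0 = 0; the remaining tuples are exactly
the compositions. Tuples are what the Cauchy product in `coeff_adj_pow` produces. -/
theorem sum_composition_nestedLie {g : ℕ → S} (hg : g 0 = 0) (w : S) (m n : ℕ) :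
    ∑ c : Composition n with c.length = m, nestedLie g w c.blocks =
      ∑ x ∈ Finset.Nat.antidiagonalTuple m n, nestedLie g w (List.ofFn x) := by
  refine Finset.sum_bij_ne_zero
    (fun c hc _ => fun i => c.blocksFun (Fin.cast (Finset.mem_filter.1 hc).2.symm i)) ?_ ?_ ?_ ?_
  · intro c hc _
    obtain rfl := (Finset.mem_filter.1 hc).2
    simp [Finset.Nat.mem_antidiagonalTuple]
  · intro c hc _ c' hc' _ h
    have h1 := (Finset.mem_filter.1 hc).2
    have h2 := (Finset.mem_filter.1 hc').2
    have := congrArg List.ofFn h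
    subst h1
    apply Composition.ext
    rw [← c.ofFn_blocksFun, ← c'.ofFn_blocksFun]
    refine this.trans ?_
    refine List.ext_getElem (by simp [h2]) fun i _ _ => by simp [Composition.blocksFun]
  · intro x hx h
    have hpos : ∀ {i}, i ∈ List.ofFn x → 0 < i := fun {i} hi => by
      rcases Nat.eq_zero_or_pos i with rfl | hi'
      · exact absurd (nestedLie_eq_zero hg w hi) h
      · exact hi'
    refine ⟨⟨List.ofFn x, hpos, ?_⟩, ?_, h, ?_⟩
    · rw [List.sum_ofFn]; exact Finset.Nat.mem_antidiagonalTuple.1 hx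
    · simp [Composition.length]
    · funext i; simp [Composition.blocksFun]
  · intro c hc _
    obtain rfl := (Finset.mem_filter.1 hc).2
    simp

theorem coeff_lie (p q : Polynomial S) (n : ℕ) :
    (p * q - q * p).coeff n = ∑ i ∈ Finset.HasAntidiagonal.antidiagonal n, ⁅p.coeff i.1, q.coeff i.2⁆ := by
  rw [Polynomial.coeff_sub, Polynomial.coeff_mul, Polynomial.coeff_mul,
    ← Finset.Nat.sum_antidiagonal_swap (f := fun i => q.coeff i.1 * p.coeff i.2),
    ← Finset.sum_sub_distrib]
  rfl

theorem coeff_adj_pow [Algebra ℚ S] (p : Polynomial S) (w : S) (m n : ℕ) :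
    ((adj p ^ m) (Polynomial.C w)).coeff n =
      ∑ x ∈ Finset.Nat.antidiagonalTuple m n, nestedLie p.coeff w (List.ofFn x) := by
  induction m generalizing n with
  | zero =>
    rcases n with _ | n
    · simp [nestedLie]
    · simp
  | succ m ih =>
    rw [pow_succ', Module.End.mul_apply, adj_apply, coeff_lie, sum_antidiagonalTuple_succ]
    refine Finset.sum_congr rfl fun i _ => ?_
    rw [ih, Ring.lie_def, Finset.mul_sum, Finset.sum_mul, ← Finset.sum_sub_distrib]
    refine Finset.sum_congr rfl fun x _ => ?_
    rw [List.ofFn_cons]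
    rfl

theorem sum_composition_eq_coeff [Algebra ℚ S] {p : Polynomial S} (hp : p.coeff 0 = 0) (w : S)
    (n M : ℕ) (hM : adj p ^ M = 0) (b : ℕ → ℚ) :
    ∑ c : Composition n, b c.length • nestedLie p.coeff w c.blocks =
      (nilEval M (PowerSeries.mk b) (adj p) (Polynomial.C w)).coeff n := by
  have h1 : ∀ N, M ≤ N → nilEval M (PowerSeries.mk b) (adj p) =
      ∑ k ∈ Finset.range N, b k • adj p ^ k := fun N hN => by
    simp only [nilEval, PowerSeries.coeff_mk]
    refine Finset.sum_subset (by simpa using hN) fun k _ hk => ?_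
    rw [pow_eq_zero_of_le (by simpa using hk) hM, smul_zero]
  -- The bound M + (n + 1) exceeds the length of every composition of n and is at least the
  -- nilpotency order.
  rw [h1 (M + (n + 1)) (by omega), LinearMap.sum_apply, Polynomial.finsetSum_coeff]
  rw [← Finset.sum_fiberwise_of_maps_to (s := Finset.univ) (t := Finset.range (M + (n + 1)))
    (g := fun c : Composition n => c.length) fun c _ => by
      have := c.length_le; simp; omega]
  refine Finset.sum_congr rfl fun k _ => ?_
  rw [LinearMap.smul_apply, Polynomial.coeff_smul, coeff_adj_pow, ← sum_composition_nestedLie hp,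
    Finset.smul_sum]
  refine Finset.sum_congr rfl fun c hc => ?_
  rw [(Finset.mem_filter.1 hc).2]

end Compositions

/-! ### Filtrations and naturality for the BCH terms -/

section BCHTerm

variable {K L : Type*} [Field K] [Ring L] [Algebra K L]

theorem bchTerm_zero (x y : L) : bchTerm K x y 0 = 0 := by
  rw [bchTerm]

theorem bchTerm_succ (x y : L) (n : ℕ) : bchTerm K x y (n + 1) =
    ((n + 1 : ℕ) : K)⁻¹ • ((2 : K)⁻¹ • ⁅x - y, bchTerm K x y n⁆ +
      ∑ c : Composition n with Even c.length, ((bernoulli c.length / c.length.factorial : ℚ) : K) •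
        nestedLie (bchTerm K x y) (x + y) c.blocks) := by
  rw [bchTerm]
  simp_rw [← foldr_blocksFun]

theorem nestedLie_mem (F : ℕ → Submodule K L)
    (hF : ∀ a b, ∀ x ∈ F a, ∀ y ∈ F b, ⁅x, y⁆ ∈ F (a + b)) {g : ℕ → L} {w : L} {d : ℕ}
    (hw : w ∈ F d) {l : List ℕ} (hg : ∀ k ∈ l, g k ∈ F k) : nestedLie g w l ∈ F (l.sum + d) := by
  induction l with
  | nil => simpa [nestedLie] using hw
  | cons k l ih =>
    rw [List.sum_cons, add_assoc]
    exact hF _ _ _ (hg k (by simp)) _ (ih fun i hi => hg i (by simp [hi]))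

/-- The terms of the Baker-Campbell-Hausdorff series respect every filtration that is compatible
with commutators. -/
theorem bchTerm_mem (F : ℕ → Submodule K L)
    (hF : ∀ a b, ∀ x ∈ F a, ∀ y ∈ F b, ⁅x, y⁆ ∈ F (a + b)) {x y : L} (hx : x ∈ F 1)
    (hy : y ∈ F 1) (n : ℕ) : bchTerm K x y n ∈ F n := by
  induction n using Nat.strong_induction_on with
  | _ n ih =>
    cases n with
    | zero => rw [bchTerm_zero]; exact zero_mem _
    | succ n =>
      rw [bchTerm_succ]
      refine Submodule.smul_mem _ _ (add_mem (Submodule.smul_mem _ _ ?_)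
        (Submodule.sum_mem _ fun c _ => Submodule.smul_mem _ _ ?_))
      · rw [add_comm n]
        exact hF _ _ _ (sub_mem hx hy) _ (ih n (Nat.lt_succ_self n))
      · have := nestedLie_mem F hF (g := bchTerm K x y) (l := c.blocks) (add_mem hx hy)
          fun k hk => ih k (Nat.lt_succ_of_le (c.blocks_le hk))
        rwa [c.blocks_sum] at this

theorem map_nestedLie {L' : Type*} [Ring L'] (φ : L →+* L') {g : ℕ → L} {g' : ℕ → L'} {w : L}
    {l : List ℕ} (h : ∀ k ∈ l, φ (g k) = g' k) :
    φ (nestedLie g w l) = nestedLie g' (φ w) l := by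
  induction l with
  | nil => rfl
  | cons k l ih =>
    simp only [nestedLie, List.foldr_cons] at ih ⊢
    rw [← ih fun i hi => h i (by simp [hi]), ← h k (by simp)]
    simp [Ring.lie_def]

theorem map_bchTerm {L' : Type*} [Ring L'] [Algebra K L'] (φ : L →ₐ[K] L') (x y : L) (n : ℕ) :
    φ (bchTerm K x y n) = bchTerm K (φ x) (φ y) n := by
  induction n using Nat.strong_induction_on with
  | _ n ih =>
    cases n with
    | zero => simp [bchTerm_zero]
    | succ n =>
      rw [bchTerm_succ, bchTerm_succ, map_smul, map_add φ, map_smul]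
      congr 3
      · rw [← ih n (Nat.lt_succ_self n)]; simp [Ring.lie_def]
      · rw [map_sum φ]
        refine Finset.sum_congr rfl fun c _ => ?_
        rw [map_smul, ← map_add φ]
        congr 1
        exact map_nestedLie (φ : L →+* L') fun k hk => ih k (Nat.lt_succ_of_le (c.blocks_le hk))

/-- Two pairs of elements related by a bracket-compatible filtration on `L × L'` have related
Baker-Campbell-Hausdorff terms. -/
theorem bchTerm_prod_mem {L' : Type*} [Ring L'] [Algebra K L'] (F : ℕ → Submodule K (L × L'))
    (hF : ∀ a b, ∀ p ∈ F a, ∀ q ∈ F b, ⁅p, q⁆ ∈ F (a + b)) {x y : L} {x' y' : L'}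
    (hx : (x, x') ∈ F 1) (hy : (y, y') ∈ F 1) (n : ℕ) :
    (bchTerm K x y n, bchTerm K x' y' n) ∈ F n := by
  -- The BCH term of the pairs is formed in the product ring; the projections are algebra maps, so
  -- its components are the two BCH terms.
  have := bchTerm_mem F hF hx hy n
  convert! this
  · exact (map_bchTerm (AlgHom.fst K L L') (x, x') (y, y') n).symm
  · exact (map_bchTerm (AlgHom.snd K L L') (x, x') (y, y') n).symm

end BCHTerm

/-! ### The BCH formula in a nilpotent filtered algebra -/

section Nilpotent

variable {K Q : Type*} [Field K] [Ring Q] [Algebra K Q]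

theorem isNilpotent_polynomial (F : ℕ → Submodule K Q)
    (hF : ∀ a b, ∀ x ∈ F a, ∀ y ∈ F b, x * y ∈ F (a + b)) {N : ℕ} (hN : F (N + 1) = ⊥)
    {p : Polynomial Q} (hp : ∀ n, p.coeff n ∈ F 1) : IsNilpotent p := by
  have key : ∀ k n, (p ^ (k + 1)).coeff n ∈ F (k + 1) := by
    intro k
    induction k with
    | zero => simpa using hp
    | succ k ih =>
      intro n
      rw [pow_succ, Polynomial.coeff_mul]
      exact sum_mem fun i _ => hF _ _ _ (ih _) _ (hp _)
  refine ⟨N + 1, Polynomial.ext fun n => ?_⟩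
  simpa [hN] using key N n

/-- Uniqueness of solutions of `F' = x F + F y`. -/
theorem polynomial_ode_unique [Algebra ℚ Q] {x y : Q} {p q : Polynomial Q}
    (hp : Polynomial.derivative p = Polynomial.C x * p + p * Polynomial.C y)
    (hq : Polynomial.derivative q = Polynomial.C x * q + q * Polynomial.C y)
    (h0 : p.coeff 0 = q.coeff 0) : p = q := by
  ext n
  induction n with
  | zero => exact h0
  | succ n ih =>
    have h1 := congrArg (fun r => Polynomial.coeff r n) hp
    have h2 := congrArg (fun r => Polynomial.coeff r n) hq
    simp only [Polynomial.coeff_derivative, Polynomial.coeff_add, Polynomial.coeff_C_mul,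
      Polynomial.coeff_mul_C] at h1 h2
    rw [ih, ← h2] at h1
    -- The equation determines (n + 1) times the next coefficient; n + 1 is invertible over ℚ.
    have hu : IsUnit ((n : Q) + 1) := by
      have : IsUnit (algebraMap ℚ Q (n + 1)) :=
        (IsUnit.mk0 (n + 1 : ℚ) (by positivity)).map (algebraMap ℚ Q)
      simpa using this
    exact hu.mul_left_injective h1

theorem coeff_zero_exp [Algebra ℚ Q] {p : Polynomial Q} (hp : IsNilpotent p)
    (h0 : p.coeff 0 = 0) : (IsNilpotent.exp p).coeff 0 = 1 := by
  have := IsNilpotent.map_exp hp (Polynomial.constantCoeff (R := Q))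
  simpa [h0] using this

/-- Evaluation at `1`. -/
noncomputable def evalOneHom (Q : Type*) [Ring Q] : Polynomial Q →+* Q :=
  Polynomial.eval₂RingHom' (RingHom.id Q) 1 fun a => Commute.one_right a

theorem derivative_exp [Algebra ℚ Q] {p : Polynomial Q} (hp : IsNilpotent p)
    (h : Commute p (Polynomial.derivative p)) :
    Polynomial.derivative (IsNilpotent.exp p) = Polynomial.derivative p * IsNilpotent.exp p := by
  have := leibniz_exp (Polynomial.derivative.restrictScalars ℚ)
    (fun x y => Polynomial.derivative_mul) hp (M := 1) (by simp [adj_apply, h.eq])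
  simpa using this

/-- The Baker-Campbell-Hausdorff formula in a nilpotent situation. -/
theorem exp_mul_exp_eq_exp_sum_bchTerm [CharZero K] [Algebra ℚ Q] (F : ℕ → Submodule K Q)
    (hF : ∀ a b, ∀ x ∈ F a, ∀ y ∈ F b, x * y ∈ F (a + b)) (hanti : Antitone F) {N : ℕ}
    (hN : F (N + 1) = ⊥) {x y : Q} (hx : x ∈ F 1) (hy : y ∈ F 1) :
    IsNilpotent.exp x * IsNilpotent.exp y =
      IsNilpotent.exp (∑ n ∈ Finset.range (N + 1), bchTerm K x y n) := by
  have hterm := bchTerm_mem F (fun a b x hx y hy => by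
    rw [Ring.lie_def]
    exact sub_mem (hF _ _ _ hx _ hy) (by rw [add_comm]; exact hF _ _ _ hy _ hx)) hx hy
  have hbig : ∀ n, N < n → bchTerm K x y n = 0 := fun n hn => by
    have := hanti (show N + 1 ≤ n from hn) (hterm n)
    simpa [hN] using this
  -- The generating function z(t) is a polynomial because the terms beyond N vanish.
  set z : Polynomial Q := ∑ n ∈ Finset.range (N + 1), Polynomial.monomial n (bchTerm K x y n)
    with hz
  have hcz : z.coeff = bchTerm K x y := by
    funext n
    rw [hz, Polynomial.finsetSum_coeff]
    simp only [Polynomial.coeff_monomial, Finset.sum_ite_eq', Finset.mem_range]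
    split_ifs with h
    · rfl
    · exact (hbig n (by omega)).symm
  have hznil : IsNilpotent z := by
    refine isNilpotent_polynomial F hF hN fun n => ?_
    rw [hcz]
    cases n with
    | zero => rw [bchTerm_zero]; exact zero_mem _
    | succ n => exact hanti (by omega) (hterm (n + 1))
  obtain ⟨M, hM⟩ := isNilpotent_adj hznil
  -- Compared coefficient by coefficient, this is the recursion `bchTerm_succ`.
  have hode : Polynomial.derivative z =
      (2 : ℚ)⁻¹ • ((Polynomial.C x - Polynomial.C y) * z - z * (Polynomial.C x - Polynomial.C y)) +
        nilEval M evenBernoulli (adj z) (Polynomial.C x + Polynomial.C y) := by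
    ext n
    rw [← Polynomial.C_add, Polynomial.coeff_add, evenBernoulli,
      ← sum_composition_eq_coeff (by rw [hcz, bchTerm_zero]) _ _ _ hM, Polynomial.coeff_derivative,
      ← Polynomial.C_sub, Polynomial.coeff_smul, Polynomial.coeff_sub, Polynomial.coeff_C_mul,
      Polynomial.coeff_mul_C, hcz, bchTerm_succ, smul_mul_assoc]
    have : ∀ w : Q, w * ((n : Q) + 1) = ((n + 1 : ℕ) : K) • w := fun w => by
      rw [Nat.cast_smul_eq_nsmul, nsmul_eq_mul, Nat.cast_succ]
      exact ((Nat.cast_commute n w).add_left (Commute.one_left w)).symm.eq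
    rw [this, smul_smul, inv_mul_cancel₀ (by exact_mod_cast Nat.succ_ne_zero n), one_smul]
    congr 1
    · rw [Ring.lie_def, ← Rat.cast_smul_eq_qsmul K]; simp
    · rw [Finset.sum_filter]
      refine Finset.sum_congr rfl fun c _ => ?_
      split_ifs
      · rw [← Rat.cast_smul_eq_qsmul K]
      · simp
  have hE := leibniz_exp_of_bch_ode (Polynomial.derivative.restrictScalars ℚ)
    (fun x y => Polynomial.derivative_mul) hznil hM hode
  have hX : ∀ w ∈ F 1, ∀ n, (Polynomial.C w * Polynomial.X).coeff n ∈ F 1 := fun w hw n => by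
    rw [Polynomial.coeff_C_mul_X]; split_ifs
    · exact hw
    · exact zero_mem _
  have hxn := isNilpotent_polynomial F hF hN (hX x hx)
  have hyn := isNilpotent_polynomial F hF hN (hX y hy)
  have hcomm : ∀ w : Q, Commute (Polynomial.C w * Polynomial.X) (Polynomial.C w) := fun w =>
    (Commute.refl _).mul_left (Polynomial.commute_X _)
  have hd : ∀ w : Q, Polynomial.derivative (Polynomial.C w * Polynomial.X) = Polynomial.C w :=
    fun w => by simp
  have hdx := derivative_exp hxn (by rw [hd]; exact hcomm x)
  have hdy := derivative_exp hyn (by rw [hd]; exact hcomm y)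
  rw [hd] at hdx hdy
  have hyc : Commute (IsNilpotent.exp (Polynomial.C y * Polynomial.X)) (Polynomial.C y) := by
    rw [IsNilpotent.exp]
    exact Commute.sum_left _ _ _ fun i _ => ((hcomm y).pow_left i).smul_left _
  have key := polynomial_ode_unique (x := x) (y := y)
    (p := IsNilpotent.exp (Polynomial.C x * Polynomial.X) *
      IsNilpotent.exp (Polynomial.C y * Polynomial.X)) (q := IsNilpotent.exp z)
    (by rw [Polynomial.derivative_mul, hdx, hdy, ← hyc.eq, mul_assoc, mul_assoc]) hE
    (by
      rw [Polynomial.mul_coeff_zero, coeff_zero_exp hxn (by simp), coeff_zero_exp hyn (by simp),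
        coeff_zero_exp hznil (by rw [hcz, bchTerm_zero]), one_mul])
  have := congrArg (evalOneHom Q) key
  rw [map_mul, IsNilpotent.map_exp hxn, IsNilpotent.map_exp hyn, IsNilpotent.map_exp hznil, hz,
    map_sum] at this
  simpa [evalOneHom] using this

end Nilpotent

/-! ### Vertex counts of trees and forests -/

section Size

/-- The number of vertices. -/
def PlaneTree.size : PlaneTree → ℕ
  | .node b => 1 + ∑ i, (b i).size

theorem PlaneTree.Iso.size_eq {s t : PlaneTree} (h : s.Iso t) : s.size = t.size := by
  induction h with
  | node σ h ih =>
    rename_i b'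
    rw [PlaneTree.size, PlaneTree.size]
    simp_rw [ih]
    rw [Equiv.sum_comp σ (fun i => (b' i).size)]

/-- The number of vertices. -/
def RTree.size (T : RTree) : ℕ := T.liftOn PlaneTree.size fun _ _ => PlaneTree.Iso.size_eq

theorem RTree.size_mk (t : PlaneTree) : (RTree.mk t).size = t.size := rfl

theorem RTree.size_graft (F : Multiset RTree) :
    (RTree.graft F).size = 1 + (F.map RTree.size).sum := by
  obtain ⟨n, b, rfl⟩ := HRT.exists_node F
  rw [← RTree.mk_node, RTree.size_mk, PlaneTree.size, Multiset.map_map]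
  rfl

theorem RTree.one_le_size (T : RTree) : 1 ≤ T.size := by
  rw [← T.mk_out, RTree.size_mk]
  cases T.out with
  | node b => rw [PlaneTree.size]; omega

/-- The number of vertices of a forest. -/
noncomputable def forestSize (s : RTree →₀ ℕ) : ℕ := (s.toMultiset.map RTree.size).sum

theorem forestSize_add (s t : RTree →₀ ℕ) : forestSize (s + t) = forestSize s + forestSize t := by
  simp [forestSize]

theorem forestSize_single (T : RTree) : forestSize (Finsupp.single T 1) = T.size := by
  simp [forestSize]

theorem forestSize_eq_zero {s : RTree →₀ ℕ} (h : forestSize s = 0) : s = 0 := by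
  classical
  suffices h' : s.toMultiset = 0 by rw [← Finsupp.toMultiset_toFinsupp s, h', map_zero]
  rw [Multiset.eq_zero_iff_forall_notMem]
  intro T hT
  have := Multiset.le_sum_of_mem (Multiset.mem_map_of_mem RTree.size hT)
  have h1 := T.one_le_size
  rw [forestSize] at h
  omega

end Size

/-! ### The vertex filtration and convergence of series -/

section Filtration

variable {K : Type*} [Field K]

theorem HRT.basis_zero : HRT.basis K 0 = 1 := by simp [HRT.basis_apply]

theorem HRT.basis_single (T : RTree) : HRT.basis K (Finsupp.single T 1) = HRT.tree K T := by
  simp [HRT.basis_apply]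

theorem HRT.basis_add (s t : RTree →₀ ℕ) :
    HRT.basis K (s + t) = HRT.basis K s * HRT.basis K t := by
  simp [HRT.basis_apply]

theorem bPlus_basis (s : RTree →₀ ℕ) :
    bPlus K (HRT.basis K s) = HRT.basis K (Finsupp.single (.graft s.toMultiset) 1) := by
  rw [HRT.basis_single, bPlus, Module.Basis.constr_basis]

variable (K) in
/-- The span of the pairs of forests with at most `n` vertices together. -/
noncomputable def tensorFiltration (n : ℕ) : Submodule K (HRT K ⊗[K] HRT K) :=
  Submodule.span K {x | ∃ s t, forestSize s + forestSize t ≤ n ∧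
    HRT.basis K s ⊗ₜ HRT.basis K t = x}

theorem basis_tmul_mem {s t : RTree →₀ ℕ} {n : ℕ} (h : forestSize s + forestSize t ≤ n) :
    HRT.basis K s ⊗ₜ HRT.basis K t ∈ tensorFiltration K n :=
  Submodule.subset_span ⟨s, t, h, rfl⟩

theorem tensorFiltration_mul {m n : ℕ} {x y : HRT K ⊗[K] HRT K} (hx : x ∈ tensorFiltration K m)
    (hy : y ∈ tensorFiltration K n) : x * y ∈ tensorFiltration K (m + n) := by
  have h : tensorFiltration K m * tensorFiltration K n ≤ tensorFiltration K (m + n) := by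
    rw [tensorFiltration, tensorFiltration, Submodule.span_mul_span, Submodule.span_le]
    rintro _ ⟨_, ⟨s, t, h, rfl⟩, _, ⟨s', t', h', rfl⟩, rfl⟩
    simp only [Algebra.TensorProduct.tmul_mul_tmul, ← HRT.basis_add]
    refine basis_tmul_mem ?_
    rw [forestSize_add, forestSize_add]
    omega
  exact h (Submodule.mul_mem_mul hx hy)

theorem one_mem_tensorFiltration (n : ℕ) : 1 ∈ tensorFiltration K n := by
  rw [Algebra.TensorProduct.one_def, ← HRT.basis_zero]
  exact basis_tmul_mem (by simp [forestSize])

theorem tensorFiltration_prod {ι : Type*} (I : Finset ι) (f : ι → HRT K ⊗[K] HRT K) (a : ι → ℕ)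
    (h : ∀ i, f i ∈ tensorFiltration K (a i)) :
    ∏ i ∈ I, f i ∈ tensorFiltration K (∑ i ∈ I, a i) := by
  classical
  induction I using Finset.induction_on with
  | empty => exact one_mem_tensorFiltration _
  | insert i I hi ih =>
    rw [Finset.prod_insert hi, Finset.sum_insert hi]
    exact tensorFiltration_mul (h i) ih

theorem tensorFiltration_bPlus {n : ℕ} {x : HRT K ⊗[K] HRT K} (hx : x ∈ tensorFiltration K n) :
    (bPlus K).lTensor (HRT K) x ∈ tensorFiltration K (1 + n) := by
  have h : tensorFiltration K n ≤
      (tensorFiltration K (1 + n)).comap ((bPlus K).lTensor (HRT K)) := by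
    rw [tensorFiltration, Submodule.span_le]
    rintro _ ⟨s, t, h, rfl⟩
    rw [SetLike.mem_coe, Submodule.mem_comap, LinearMap.lTensor_tmul, bPlus_basis]
    refine basis_tmul_mem ?_
    rw [forestSize_single, RTree.size_graft]
    rw [forestSize, forestSize] at h
    rw [forestSize]
    omega
  exact h hx

/-- Induction along the recursion `treeCoproduct_node`: the branches contribute their sizes, and
grafting adds the single new root. -/
theorem treeCoproduct_mem (t : PlaneTree) : treeCoproduct K t ∈ tensorFiltration K t.size := by
  induction t with
  | node b ih =>
    rw [treeCoproduct_node]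
    refine add_mem ?_ ?_
    · rw [← HRT.basis_single, ← HRT.basis_zero]
      refine basis_tmul_mem ?_
      rw [forestSize_single, RTree.size_mk]
      simp [forestSize]
    · rw [PlaneTree.size]
      exact tensorFiltration_bPlus (tensorFiltration_prod _ _ _ ih)

theorem comul_basis_mem (s : RTree →₀ ℕ) :
    HRT.comul K (HRT.basis K s) ∈ tensorFiltration K (forestSize s) := by
  rw [HRT.basis_apply, forestSize]
  induction s.toMultiset using Multiset.induction_on with
  | empty => simpa using one_mem_tensorFiltration 0
  | cons T F ih =>
    rw [Multiset.map_cons, Multiset.map_cons, Multiset.prod_cons, map_mul, Multiset.sum_cons]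
    refine tensorFiltration_mul ?_ ih
    rw [← T.mk_out, HRT.comul_mk]
    exact treeCoproduct_mem _

variable {A : Type*} [CommRing A] [Algebra K A]

theorem Conv.ext_basis {f g : Conv K A} (h : ∀ s, f (HRT.basis K s) = g (HRT.basis K s)) : f = g :=
  WithConv.ext ((HRT.basis K).ext h)

variable (K A) in
/-- The linear maps that vanish on all forests with fewer than `N` vertices. -/
def vanishing (N : ℕ) : Submodule K (Conv K A) where
  carrier := {f | ∀ s, forestSize s < N → f (HRT.basis K s) = 0}
  add_mem' hf hg s hs := by
    rw [WithConv.ofConv_add, LinearMap.add_apply, hf s hs, hg s hs, add_zero]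
  zero_mem' _ _ := rfl
  smul_mem' c f hf s hs := by
    rw [WithConv.ofConv_smul, LinearMap.smul_apply, hf s hs, smul_zero]

theorem vanishing_antitone : Antitone (vanishing K A) :=
  fun _ _ h _ hf s hs => hf s (hs.trans_le h)

theorem mem_vanishing_zero (f : Conv K A) : f ∈ vanishing K A 0 := fun _ h => by omega

theorem eq_of_sub_mem_vanishing {f g : Conv K A} (h : ∀ N, f - g ∈ vanishing K A N) : f = g :=
  Conv.ext_basis fun s => sub_eq_zero.1 (h (forestSize s + 1) s (Nat.lt_succ_self _))

theorem vanishing_mul (a b : ℕ) (f : Conv K A) (hf : f ∈ vanishing K A a) (g : Conv K A)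
    (hg : g ∈ vanishing K A b) : f * g ∈ vanishing K A (a + b) := by
  intro s hs
  have h : tensorFiltration K (forestSize s) ≤
      LinearMap.ker (LinearMap.mul' K A ∘ₗ TensorProduct.map f.ofConv g.ofConv) := by
    rw [tensorFiltration, Submodule.span_le]
    rintro _ ⟨t, t', h, rfl⟩
    rw [SetLike.mem_coe, LinearMap.mem_ker, LinearMap.comp_apply, TensorProduct.map_tmul,
      LinearMap.mul'_apply]
    -- The two sizes add up to less than a + b, so the first is below a or the second is below b.
    by_cases ht : forestSize t < a
    · rw [hf t ht, zero_mul]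
    · rw [hg t' (by omega), mul_zero]
  exact LinearMap.mem_ker.1 (h (comul_basis_mem s))

theorem vanishing_lie (a b : ℕ) (f : Conv K A) (hf : f ∈ vanishing K A a) (g : Conv K A)
    (hg : g ∈ vanishing K A b) : ⁅f, g⁆ ∈ vanishing K A (a + b) := by
  rw [Ring.lie_def]
  exact sub_mem (vanishing_mul _ _ _ hf _ hg) (by rw [add_comm]; exact vanishing_mul _ _ _ hg _ hf)

/-- An element involves finitely many forests, so one N larger than all their sizes works. This
makes filtration convergence pointwise finite. -/
theorem exists_apply_eq_zero (A : Type*) [CommRing A] [Algebra K A] (x : HRT K) :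
    ∃ N, ∀ f ∈ vanishing K A N, f x = 0 := by
  induction (HRT.basis K).mem_span x using Submodule.span_induction with
  | mem x hx =>
    obtain ⟨s, rfl⟩ := hx
    exact ⟨forestSize s + 1, fun f hf => hf s (Nat.lt_succ_self _)⟩
  | zero => exact ⟨0, fun f _ => map_zero _⟩
  | add x y _ _ hx hy =>
    obtain ⟨N, hN⟩ := hx
    obtain ⟨M, hM⟩ := hy
    exact ⟨max N M, fun f hf => by
      rw [map_add, hN f (vanishing_antitone (le_max_left _ _) hf),
        hM f (vanishing_antitone (le_max_right _ _) hf), add_zero]⟩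
  | smul c x _ hx =>
    obtain ⟨N, hN⟩ := hx
    exact ⟨N, fun f hf => by rw [map_smul, hN f hf, smul_zero]⟩

theorem pointwiseFinite_of_mem {f : ℕ → Conv K A} (hf : ∀ k, f k ∈ vanishing K A k) :
    PointwiseFinite f := by
  intro x
  obtain ⟨N, hN⟩ := exists_apply_eq_zero A x
  refine (Set.finite_lt_nat N).subset fun k hk => ?_
  by_contra h
  exact hk (hN _ (vanishing_antitone (not_lt.1 h) (hf k)))

/-- `v` is the sum of the series `f`: the partial sums converge to `v` in the topology given by the
filtration `vanishing`. -/
def IsSum (f : ℕ → Conv K A) (v : Conv K A) : Prop :=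
  ∀ N, v - ∑ k ∈ Finset.range N, f k ∈ vanishing K A N

theorem IsSum.unique {f : ℕ → Conv K A} {v w : Conv K A} (hv : IsSum f v) (hw : IsSum f w) :
    v = w :=
  eq_of_sub_mem_vanishing fun N => by simpa using sub_mem (hv N) (hw N)

theorem isSum_seriesSum {f : ℕ → Conv K A} (hf : ∀ k, f k ∈ vanishing K A k) :
    IsSum f (seriesSum f) := by
  intro N s hs
  rw [WithConv.ofConv_sub, LinearMap.sub_apply, seriesSum, WithConv.ofConv_toConv,
    Module.Basis.constr_basis, WithConv.ofConv_sum, LinearMap.sum_apply, sub_eq_zero]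
  refine finsum_eq_sum_of_support_subset _ fun k hk => ?_
  rw [Finset.coe_range, Set.mem_Iio]
  by_contra h
  exact hk (hf k s (by omega))

theorem IsSum.exists_apply {f : ℕ → Conv K A} {v : Conv K A} (h : IsSum f v) (x : HRT K) :
    ∃ N, ∀ M, N ≤ M → v x = ∑ k ∈ Finset.range M, f k x := by
  obtain ⟨N, hN⟩ := exists_apply_eq_zero A x
  refine ⟨N, fun M hM => ?_⟩
  have := hN _ (vanishing_antitone hM (h M))
  rw [WithConv.ofConv_sub, LinearMap.sub_apply, WithConv.ofConv_sum, LinearMap.sum_apply,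
    sub_eq_zero] at this
  exact this

end Filtration

/-! ### Infinitesimal characters form a Lie algebra -/

section InfChar

variable {K A : Type*} [Field K] [CommRing A] [Algebra K A]

theorem convOne_apply' (x : HRT K) : (1 : Conv K A) x = algebraMap K A (HRT.counit K x) := rfl

theorem IsInfChar.map_mul' {Z : Conv K A} (hZ : IsInfChar Z) (x y : HRT K) :
    Z (x * y) = Z x * (1 : Conv K A) y + (1 : Conv K A) x * Z y := by
  rw [hZ, convOne_apply', convOne_apply', Algebra.smul_def, Algebra.smul_def, mul_comm (Z x)]

theorem IsInfChar.mem_vanishing {Z : Conv K A} (hZ : IsInfChar Z) : Z ∈ vanishing K A 1 := by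
  intro s hs
  obtain rfl := forestSize_eq_zero (Nat.lt_one_iff.1 hs)
  rw [HRT.basis_zero]
  simpa using hZ 1 1

theorem IsInfChar.conv_mul_apply {f g : Conv K A} (hf : IsInfChar f) (hg : IsInfChar g)
    (x y : HRT K) : (f * g) (x * y) = (f * g) x * (1 : Conv K A) y + f x * g y + g x * f y +
      (1 : Conv K A) x * (f * g) y := by
  -- On pure tensors the derivation rule for f and for g gives two terms each, and their product
  -- gives the four terms here.
  have key : ∀ a b : HRT K ⊗[K] HRT K,
      LinearMap.mul' K A (TensorProduct.map f.ofConv g.ofConv (a * b)) =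
      LinearMap.mul' K A (TensorProduct.map f.ofConv g.ofConv a) *
        LinearMap.mul' K A (TensorProduct.map (1 : Conv K A).ofConv (1 : Conv K A).ofConv b) +
      LinearMap.mul' K A (TensorProduct.map f.ofConv (1 : Conv K A).ofConv a) *
        LinearMap.mul' K A (TensorProduct.map (1 : Conv K A).ofConv g.ofConv b) +
      LinearMap.mul' K A (TensorProduct.map (1 : Conv K A).ofConv g.ofConv a) *
        LinearMap.mul' K A (TensorProduct.map f.ofConv (1 : Conv K A).ofConv b) +
      LinearMap.mul' K A (TensorProduct.map (1 : Conv K A).ofConv (1 : Conv K A).ofConv a) *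
        LinearMap.mul' K A (TensorProduct.map f.ofConv g.ofConv b) := by
    intro a b
    induction a with
    | zero => simp
    | add a a' ha ha' => simp only [add_mul, map_add, ha, ha']; ring
    | tmul a a' =>
      induction b with
      | zero => simp
      | add b b' hb hb' => simp only [mul_add, map_add, hb, hb']; ring
      | tmul b b' =>
        simp only [Algebra.TensorProduct.tmul_mul_tmul, TensorProduct.map_tmul,
          LinearMap.mul'_apply, hf.map_mul', hg.map_mul']
        ring
  have h1 : ∀ (u v : Conv K A) (z : HRT K), (u * v) z =
    LinearMap.mul' K A (TensorProduct.map u.ofConv v.ofConv (HRT.comul K z)) := fun _ _ _ => rfl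
  rw [h1, map_mul, key, ← h1, ← h1, ← h1, ← h1, ← h1, ← h1, ← h1, ← h1, one_mul, one_mul, mul_one]

variable (K A) in
/-- The submodule of infinitesimal characters. -/
def infChar : Submodule K (Conv K A) where
  carrier := {f | IsInfChar f}
  add_mem' hf hg x y := by
    simp only [WithConv.ofConv_add, LinearMap.add_apply, smul_add]
    rw [hf, hg]
    abel
  zero_mem' x y := by simp
  smul_mem' _ _ hf x y := by
    simp only [WithConv.ofConv_smul, LinearMap.smul_apply]
    rw [hf, smul_add, smul_comm (HRT.counit K y), smul_comm (HRT.counit K x)]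

/-- In `IsInfChar.conv_mul_apply` the cross terms f(x) g(y) + g(x) f(y) are symmetric in f and g, so
they cancel in the commutator. -/
theorem infChar_lie {f g : Conv K A} (hf : f ∈ infChar K A) (hg : g ∈ infChar K A) :
    ⁅f, g⁆ ∈ infChar K A := by
  intro x y
  rw [Ring.lie_def]
  simp only [WithConv.ofConv_sub, LinearMap.sub_apply]
  rw [IsInfChar.conv_mul_apply hf hg, IsInfChar.conv_mul_apply hg hf, Algebra.smul_def,
    Algebra.smul_def, convOne_apply', convOne_apply']
  ring

theorem IsSum.isInfChar {f : ℕ → Conv K A} {v : Conv K A} (h : IsSum f v)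
    (hf : ∀ k, IsInfChar (f k)) : IsInfChar v := by
  intro x y
  obtain ⟨N₁, h₁⟩ := h.exists_apply (x * y)
  obtain ⟨N₂, h₂⟩ := h.exists_apply x
  obtain ⟨N₃, h₃⟩ := h.exists_apply y
  rw [h₁ (N₁ + N₂ + N₃) (by omega), h₂ (N₁ + N₂ + N₃) (by omega), h₃ (N₁ + N₂ + N₃) (by omega),
    Finset.smul_sum, Finset.smul_sum, ← Finset.sum_add_distrib]
  exact Finset.sum_congr rfl fun k _ => hf k x y

end InfChar

/-! ### Postcomposition with a linear map -/

section Post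

variable {K A : Type*} [Field K] [CommRing A] [Algebra K A]

/-- Postcomposition as a linear map. -/
noncomputable def postHom (P : A →ₗ[K] A) : Conv K A →ₗ[K] Conv K A where
  toFun := post P
  map_add' _ _ := WithConv.ext (LinearMap.comp_add _ _ _)
  map_smul' _ _ := WithConv.ext (LinearMap.comp_smul _ _ _)

theorem postHom_apply (P : A →ₗ[K] A) (f : Conv K A) : postHom P f = post P f := rfl

theorem post_mem_vanishing (P : A →ₗ[K] A) {f : Conv K A} {N : ℕ} (hf : f ∈ vanishing K A N) :
    post P f ∈ vanishing K A N := fun s hs =>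
  (congrArg P (hf s hs)).trans (map_zero P)

theorem post_mem_infChar (P : A →ₗ[K] A) {f : Conv K A} (hf : f ∈ infChar K A) :
    post P f ∈ infChar K A := fun x y => by
  change P (f (x * y)) = _ • P (f x) + _ • P (f y)
  rw [hf, map_add, map_smul, map_smul]

theorem IsSum.post (P : A →ₗ[K] A) {f : ℕ → Conv K A} {v : Conv K A} (h : IsSum f v) :
    IsSum (fun k => post P (f k)) (post P v) := by
  intro N
  have := post_mem_vanishing P (h N)
  simpa only [← postHom_apply, map_sub, map_sum] using this

theorem post_add_post_id_sub (R : A →ₗ[K] A) (f : Conv K A) :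
    CK.post R f + CK.post (LinearMap.id - R) f = f := by
  apply WithConv.ext
  ext x
  simp [CK.post]

end Post

/-! ### Operations on convergent series -/

section Sums

variable {K A : Type*} [Field K] [CommRing A] [Algebra K A]

theorem IsSum.shift {f : ℕ → Conv K A} {v : Conv K A} (hf : ∀ k, f k ∈ vanishing K A k)
    (h : IsSum (fun k => f (k + 1)) v) : IsSum f (f 0 + v) := by
  intro N
  -- The N-th partial sum of the shifted series also contains f N, which is negligible at level N.
  have h1 := add_mem (h N) (hf N)
  have h2 := Finset.sum_range_succ' f N
  rw [Finset.sum_range_succ] at h2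
  convert h1 using 1
  rw [eq_sub_of_add_eq h2]
  abel

theorem IsSum.neg {f : ℕ → Conv K A} {v : Conv K A} (h : IsSum f v) :
    IsSum (fun k => -f k) (-v) := by
  intro N
  have := neg_mem (h N)
  rw [Finset.sum_neg_distrib]
  convert this using 1
  abel

theorem IsSum.mul_right {f : ℕ → Conv K A} {v : Conv K A} (h : IsSum f v) (w : Conv K A) :
    IsSum (fun k => f k * w) (v * w) := by
  intro N
  rw [← Finset.sum_mul, ← sub_mul]
  exact vanishing_mul N 0 _ (h N) w (mem_vanishing_zero w)

theorem IsSum.mul_left {f : ℕ → Conv K A} {v : Conv K A} (h : IsSum f v) (w : Conv K A) :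
    IsSum (fun k => w * f k) (w * v) := by
  intro N
  rw [← Finset.mul_sum, ← mul_sub]
  simpa using vanishing_mul 0 N w (mem_vanishing_zero w) _ (h N)

/-- Summation of a double series along the antidiagonals. -/
theorem IsSum.antidiagonal {c : ℕ → ℕ → Conv K A} {d : ℕ → Conv K A} {v : Conv K A}
    (hc : ∀ i j, c i j ∈ vanishing K A (i + j)) (hd : ∀ i, IsSum (c i) (d i)) (h : IsSum d v) :
    IsSum (fun n => ∑ p ∈ Finset.HasAntidiagonal.antidiagonal n, c p.1 p.2) v := by
  intro N
  have h1 : ∑ i ∈ Finset.range N, (d i - ∑ j ∈ Finset.range N, c i j) ∈ vanishing K A N :=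
    sum_mem fun i _ => hd i N
  -- The square of indices splits into the triangle, which is the antidiagonal partial sum, and a
  -- rest whose terms lie in level N.
  have h2 : ∑ p ∈ Finset.range N ×ˢ Finset.range N with p.1 + p.2 < N, c p.1 p.2 =
      ∑ n ∈ Finset.range N, ∑ p ∈ Finset.HasAntidiagonal.antidiagonal n, c p.1 p.2 := by
    rw [← Finset.sum_fiberwise_of_maps_to (t := Finset.range N) (g := fun p => p.1 + p.2)
      (by simp)]
    refine Finset.sum_congr rfl fun n hn => Finset.sum_congr ?_ fun _ _ => rfl
    ext p
    simp only [Finset.mem_filter, Finset.mem_product, Finset.mem_range,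
      Finset.HasAntidiagonal.mem_antidiagonal] at hn ⊢
    omega
  have h3 := Finset.sum_filter_add_sum_filter_not (Finset.range N ×ˢ Finset.range N)
    (fun p => p.1 + p.2 < N) fun p => c p.1 p.2
  rw [h2, Finset.sum_product] at h3
  have h4 : ∑ p ∈ Finset.range N ×ˢ Finset.range N with ¬ p.1 + p.2 < N, c p.1 p.2 ∈
      vanishing K A N := sum_mem fun p hp =>
    vanishing_antitone (not_lt.1 (Finset.mem_filter.1 hp).2) (hc _ _)
  have h5 := add_mem (add_mem (h N) h1) h4
  rw [Finset.sum_sub_distrib, ← h3] at h5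
  convert h5 using 1
  abel

end Sums

/-! ### The BCH formula for the convolution exponential -/

section Exponential

variable {K A : Type*} [Field K] [CommRing A] [Algebra K A]

theorem pow_mem_vanishing {Z : Conv K A} (hZ : Z ∈ vanishing K A 1) (k : ℕ) :
    Z ^ k ∈ vanishing K A k := by
  induction k with
  | zero => exact mem_vanishing_zero _
  | succ k ih => rw [pow_succ]; exact vanishing_mul _ _ _ ih _ hZ

theorem expTerm_mem_vanishing {Z : Conv K A} (hZ : Z ∈ vanishing K A 1) (k : ℕ) :
    expTerm Z k ∈ vanishing K A k :=
  Submodule.smul_mem _ _ (pow_mem_vanishing hZ k)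

theorem bchTerm_mem_vanishing {x y : Conv K A} (hx : x ∈ vanishing K A 1)
    (hy : y ∈ vanishing K A 1) (k : ℕ) : bchTerm K x y k ∈ vanishing K A k :=
  bchTerm_mem (vanishing K A) vanishing_lie hx hy k

theorem bchTerm_one {L : Type*} [Ring L] [Algebra K L] [CharZero K] (x y : L) :
    bchTerm K x y 1 = x + y := by
  rw [bchTerm_succ, bchTerm_zero, Finset.sum_filter,
    Fintype.sum_eq_single (default : Composition 0) fun c hc => absurd (Composition.ext (by
      rw [(Composition.blocks_eq_nil _).2 rfl, (Composition.blocks_eq_nil _).2 rfl])) hc]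
  have h : (default : Composition 0).blocks = [] := by rw [Composition.blocks_eq_nil]
  simp [Composition.length, h, nestedLie, Ring.lie_def]

theorem isSum_bch {x y : Conv K A} (hx : x ∈ vanishing K A 1) (hy : y ∈ vanishing K A 1) :
    IsSum (fun k => bchDepth (K := K) x y (k + 1)) (bch x y) :=
  isSum_seriesSum fun k =>
    vanishing_antitone (by omega) (bchTerm_mem_vanishing hx hy (k + 1 + 1))

theorem isSum_bchTerm [CharZero K] {x y : Conv K A} (hx : x ∈ vanishing K A 1)
    (hy : y ∈ vanishing K A 1) : IsSum (bchTerm K x y) (x + y + bch x y) := by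
  have h1 := IsSum.shift (f := fun k => bchTerm K x y (k + 1))
    (fun k => vanishing_antitone (by omega) (bchTerm_mem_vanishing hx hy (k + 1)))
    (isSum_bch hx hy)
  have h2 := IsSum.shift (f := bchTerm K x y) (bchTerm_mem_vanishing hx hy) h1
  simpa only [bchTerm_zero, zero_add, bchTerm_one] using h2

theorem isSum_expStar {Z : Conv K A} (hZ : Z ∈ vanishing K A 1) :
    IsSum (expTerm Z) (expStar Z) :=
  isSum_seriesSum (expTerm_mem_vanishing hZ)

variable (K A) in
/-- `vanishing` as an ideal. -/
def vanishingIdeal (N : ℕ) : Ideal (Conv K A) where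
  __ := (vanishing K A N).toAddSubmonoid
  smul_mem' f g hg := by
    have := vanishing_mul 0 N f (mem_vanishing_zero f) g hg
    rwa [zero_add] at this

instance (N : ℕ) : (vanishingIdeal K A N).IsTwoSided where
  mul_mem_of_left g hf := vanishing_mul N 0 _ hf g (mem_vanishing_zero g)

theorem mk_eq_zero_iff {N : ℕ} {f : Conv K A} :
    Ideal.Quotient.mkₐ K (vanishingIdeal K A N) f = 0 ↔ f ∈ vanishing K A N :=
  Ideal.Quotient.eq_zero_iff_mem

theorem mk_expStar [CharZero K] {N : ℕ} [Algebra ℚ (Conv K A ⧸ vanishingIdeal K A N)]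
    {Z : Conv K A} (hZ : Z ∈ vanishing K A 1) :
    Ideal.Quotient.mkₐ K (vanishingIdeal K A N) (expStar Z) =
      IsNilpotent.exp (Ideal.Quotient.mkₐ K (vanishingIdeal K A N) Z) := by
  rw [IsNilpotent.exp_eq_sum (k := N) (by
    rw [← map_pow, mk_eq_zero_iff]; exact pow_mem_vanishing hZ N)]
  have h := mk_eq_zero_iff.2 (isSum_expStar hZ N)
  rw [map_sub, sub_eq_zero] at h
  rw [h, map_sum]
  refine Finset.sum_congr rfl fun k _ => ?_
  rw [expTerm, map_smul, map_pow, ← Rat.cast_smul_eq_qsmul K]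
  simp

/-- The Baker-Campbell-Hausdorff formula for the convolution exponential. -/
theorem expStar_mul_expStar [CharZero K] {x y : Conv K A} (hx : x ∈ vanishing K A 1)
    (hy : y ∈ vanishing K A 1) : expStar x * expStar y = expStar (x + y + bch x y) := by
  refine eq_of_sub_mem_vanishing fun N => vanishing_antitone (Nat.le_succ N) ?_
  -- `IsNilpotent.exp` needs rational scalars; they act through K.
  let _ : Algebra ℚ (Conv K A ⧸ vanishingIdeal K A (N + 1)) :=
    Algebra.compHom _ (algebraMap ℚ K)
  set q := Ideal.Quotient.mkₐ K (vanishingIdeal K A (N + 1)) with hq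
  have hs := isSum_bchTerm hx hy
  have hsum : x + y + bch x y ∈ vanishing K A 1 := by
    simpa [bchTerm_zero] using hs 1
  have h1 := mk_eq_zero_iff.2 (hs (N + 1))
  rw [map_sub, sub_eq_zero, map_sum] at h1
  rw [← mk_eq_zero_iff, map_sub, map_mul, mk_expStar hx, mk_expStar hy, mk_expStar hsum, h1,
    sub_eq_zero]
  simp only [map_bchTerm]
  -- The image of the vertex filtration in the quotient is multiplicative and vanishes at step N +
  -- 1.
  refine exp_mul_exp_eq_exp_sum_bchTerm (fun n => (vanishing K A n).map q.toLinearMap) ?_ ?_ ?_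
    (Submodule.mem_map_of_mem hx) (Submodule.mem_map_of_mem hy)
  · rintro a b _ ⟨f, hf, rfl⟩ _ ⟨g, hg, rfl⟩
    exact ⟨f * g, vanishing_mul a b f hf g hg, map_mul q f g⟩
  · exact fun a b h => Submodule.map_mono (vanishing_antitone h)
  · rw [eq_bot_iff]
    rintro _ ⟨f, hf, rfl⟩
    exact mk_eq_zero_iff.2 hf

end Exponential

theorem existsUnique_recursion {α : Type*} [Inhabited α] (Φ : (ℕ → α) → ℕ → α)
    (h : ∀ f g n, (∀ k < n, f k = g k) → Φ f n = Φ g n) :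
    ∃ f, (∀ n, f n = Φ f n) ∧ ∀ g, (∀ n, g n = Φ g n) → g = f := by
  let step : (n : ℕ) → ((k : ℕ) → k < n → α) → α := fun n r =>
    -- Entries from n on are filled arbitrarily; by `h` they do not affect the value.
    Φ (fun k => if hk : k < n then r k hk else default) n
  let f : ℕ → α := WellFounded.fix Nat.lt_wfRel.wf step
  have hf : ∀ n, f n = Φ f n := fun n => by
    have h1 : f n = step n fun k _ => f k := WellFounded.fix_eq _ _ _
    rw [h1]
    refine h _ _ _ fun k hk => ?_
    simp [hk]
  refine ⟨f, hf, fun g hg => funext fun n => ?_⟩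
  induction n using Nat.strong_induction_on with
  | _ n ih => rw [hg, hf, h g f n ih]

/-! ### BCH terms of power series in u -/

section PowerSeries

variable {K L : Type*} [Field K] [Ring L] [Algebra K L]

theorem coeff_powerSeries_lie (a b : PowerSeries L) (n : ℕ) :
    PowerSeries.coeff n ⁅a, b⁆ = ∑ i ∈ Finset.HasAntidiagonal.antidiagonal n,
      ⁅PowerSeries.coeff i.1 a, PowerSeries.coeff i.2 b⁆ := by
  rw [Ring.lie_def, map_sub, PowerSeries.coeff_mul, PowerSeries.coeff_mul,
    ← Finset.Nat.sum_antidiagonal_swap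
      (f := fun i => PowerSeries.coeff i.1 b * PowerSeries.coeff i.2 a),
    ← Finset.sum_sub_distrib]
  rfl

/-- The coefficients below `u ^ m` of the Baker-Campbell-Hausdorff terms depend only on the
coefficients below `u ^ m`. -/
theorem coeff_bchTerm_congr {x y x' y' : PowerSeries L} {m : ℕ}
    (hx : ∀ i < m, PowerSeries.coeff i x = PowerSeries.coeff i x')
    (hy : ∀ i < m, PowerSeries.coeff i y = PowerSeries.coeff i y') (n : ℕ) :
    ∀ i < m, PowerSeries.coeff i (bchTerm K x y n) = PowerSeries.coeff i (bchTerm K x' y' n) := by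
  let F : Submodule K (PowerSeries L × PowerSeries L) :=
    { carrier := {p | ∀ i < m, PowerSeries.coeff i p.1 = PowerSeries.coeff i p.2}
      add_mem' := fun hp hq i hi => by
        rw [Prod.fst_add, Prod.snd_add, map_add, map_add, hp i hi, hq i hi]
      zero_mem' := fun _ _ => rfl
      smul_mem' := fun c p hp i hi => by
        rw [Prod.smul_fst, Prod.smul_snd, PowerSeries.coeff_smul, PowerSeries.coeff_smul,
          hp i hi] }
  refine bchTerm_prod_mem (fun _ => F) (fun _ _ p hp q hq i hi => ?_) hx hy n
  change PowerSeries.coeff i ⁅p.1, q.1⁆ = PowerSeries.coeff i ⁅p.2, q.2⁆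
  rw [coeff_powerSeries_lie, coeff_powerSeries_lie]
  refine Finset.sum_congr rfl fun j hj => ?_
  rw [Finset.HasAntidiagonal.mem_antidiagonal] at hj
  rw [hp _ (by omega), hq _ (by omega)]

/-- The u-degree and the bracket degree both add up under commutators. The cutoff m permits use
inside an induction where only lower coefficients are under control. -/
theorem coeff_bchTerm_mem (V : ℕ → Submodule K L)
    (hV : ∀ a b, ∀ x ∈ V a, ∀ y ∈ V b, ⁅x, y⁆ ∈ V (a + b)) {x y : PowerSeries L} {m : ℕ}
    (hx : ∀ i < m, PowerSeries.coeff i x ∈ V (i + 1))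
    (hy : ∀ i < m, PowerSeries.coeff i y ∈ V (i + 1)) (n : ℕ) :
    ∀ i < m, PowerSeries.coeff i (bchTerm K x y n) ∈ V (i + n) := by
  let F : ℕ → Submodule K (PowerSeries L) := fun d =>
    { carrier := {p | ∀ i < m, PowerSeries.coeff i p ∈ V (i + d)}
      add_mem' := fun hp hq i hi => by rw [map_add]; exact add_mem (hp i hi) (hq i hi)
      zero_mem' := fun i _ => by rw [map_zero]; exact zero_mem _
      smul_mem' := fun c p hp i hi => by
        rw [PowerSeries.coeff_smul]; exact Submodule.smul_mem _ _ (hp i hi) }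
  refine bchTerm_mem F (fun a b p hp q hq i hi => ?_) hx hy n
  rw [coeff_powerSeries_lie]
  refine sum_mem fun j hj => ?_
  rw [Finset.HasAntidiagonal.mem_antidiagonal] at hj
  have := hV _ _ _ (hp j.1 (by omega)) _ (hq j.2 (by omega))
  rwa [show j.1 + a + (j.2 + b) = i + (a + b) by omega] at this

end PowerSeries

/-! ### Evaluation at u = 1 and the fixed point equation -/

variable {K A : Type*} [Field K] [CommRing A] [Algebra K A]

theorem IsSum.powerSeries_mul {a b : PowerSeries (Conv K A)} {v w : Conv K A}
    (ha : ∀ i, PowerSeries.coeff i a ∈ vanishing K A i)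
    (hb : ∀ i, PowerSeries.coeff i b ∈ vanishing K A i)
    (hv : IsSum (fun i => PowerSeries.coeff i a) v)
    (hw : IsSum (fun i => PowerSeries.coeff i b) w) :
    IsSum (fun i => PowerSeries.coeff i (a * b)) (v * w) := by
  simp only [PowerSeries.coeff_mul]
  exact IsSum.antidiagonal
    (c := fun i j => PowerSeries.coeff i a * PowerSeries.coeff j b)
    (d := fun i => PowerSeries.coeff i a * w)
    (fun i j => vanishing_mul _ _ _ (ha i) _ (hb j)) (fun i => hw.mul_left _) (hv.mul_right w)

/-- Evaluation at `u = 1` commutes with the Baker-Campbell-Hausdorff terms. -/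
theorem isSum_coeff_bchTerm {x y : PowerSeries (Conv K A)} {v w : Conv K A}
    (hx : ∀ i, PowerSeries.coeff i x ∈ vanishing K A i)
    (hy : ∀ i, PowerSeries.coeff i y ∈ vanishing K A i)
    (hv : IsSum (fun i => PowerSeries.coeff i x) v)
    (hw : IsSum (fun i => PowerSeries.coeff i y) w) (n : ℕ) :
    IsSum (fun i => PowerSeries.coeff i (bchTerm K x y n)) (bchTerm K v w n) := by
  -- Pairs of a series and its value at u = 1 are closed under products, hence under commutators.
  let F : Submodule K (PowerSeries (Conv K A) × Conv K A) :=
    { carrier := {p | (∀ i, PowerSeries.coeff i p.1 ∈ vanishing K A i) ∧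
        IsSum (fun i => PowerSeries.coeff i p.1) p.2}
      add_mem' := fun {p q} hp hq => ⟨fun i => by
          rw [Prod.fst_add, map_add]; exact add_mem (hp.1 i) (hq.1 i), fun N => by
          have := add_mem (hp.2 N) (hq.2 N)
          simp only [Prod.fst_add, Prod.snd_add, map_add, Finset.sum_add_distrib]
          convert this using 1
          abel⟩
      zero_mem' := ⟨fun i => by simp, fun N => by simp⟩
      smul_mem' := fun c p hp => ⟨fun i => by
          rw [Prod.smul_fst, PowerSeries.coeff_smul]; exact Submodule.smul_mem _ _ (hp.1 i),
        fun N => by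
          have := Submodule.smul_mem _ c (hp.2 N)
          rw [smul_sub, Finset.smul_sum] at this
          exact this⟩ }
  have hmul : ∀ p ∈ F, ∀ q ∈ F, p * q ∈ F := fun p hp q hq =>
    ⟨fun i => by
      rw [Prod.fst_mul, PowerSeries.coeff_mul]
      refine sum_mem fun j hj => ?_
      rw [← Finset.HasAntidiagonal.mem_antidiagonal.1 hj]
      exact vanishing_mul _ _ _ (hp.1 _) _ (hq.1 _),
      IsSum.powerSeries_mul hp.1 hq.1 hp.2 hq.2⟩
  exact (bchTerm_prod_mem (fun _ => F) (fun _ _ p hp q hq => by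
    rw [Ring.lie_def]; exact sub_mem (hmul p hp q hq) (hmul q hq p hp)) ⟨hx, hv⟩ ⟨hy, hw⟩ n).2

/-- The Baker-Campbell-Hausdorff terms of pairs that agree to order `M + 1`. -/
theorem bchTerm_sub_mem {x y x' y' : Conv K A} (hx : x ∈ vanishing K A 1)
    (hy : y ∈ vanishing K A 1) (hx' : x' ∈ vanishing K A 1) (hy' : y' ∈ vanishing K A 1) {M : ℕ}
    (hxx : x - x' ∈ vanishing K A (M + 1)) (hyy : y - y' ∈ vanishing K A (M + 1)) (n : ℕ) :
    bchTerm K x y n - bchTerm K x' y' n ∈ vanishing K A (M + n) := by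
  let F : ℕ → Submodule K (Conv K A × Conv K A) := fun d =>
    { carrier := {p | p.1 ∈ vanishing K A d ∧ p.2 ∈ vanishing K A d ∧
        p.1 - p.2 ∈ vanishing K A (M + d)}
      add_mem' := fun {p q} hp hq => ⟨add_mem hp.1 hq.1, add_mem hp.2.1 hq.2.1, by
        rw [Prod.fst_add, Prod.snd_add, add_sub_add_comm]; exact add_mem hp.2.2 hq.2.2⟩
      zero_mem' := ⟨zero_mem _, zero_mem _, by simp⟩
      smul_mem' := fun c p hp => ⟨Submodule.smul_mem _ _ hp.1, Submodule.smul_mem _ _ hp.2.1, by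
        have := Submodule.smul_mem _ c hp.2.2
        rwa [smul_sub] at this⟩ }
  -- Telescoping the difference of products preserves the surplus M.
  have hmul : ∀ a b, ∀ p ∈ F a, ∀ q ∈ F b, p * q ∈ F (a + b) := fun a b p hp q hq =>
    ⟨vanishing_mul _ _ _ hp.1 _ hq.1, vanishing_mul _ _ _ hp.2.1 _ hq.2.1, by
      rw [Prod.fst_mul, Prod.snd_mul,
        show p.1 * q.1 - p.2 * q.2 = (p.1 - p.2) * q.1 + p.2 * (q.1 - q.2) by
          rw [sub_mul, mul_sub]; abel]
      have h1 := vanishing_mul _ _ _ hp.2.2 _ hq.1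
      have h2 := vanishing_mul _ _ _ hp.2.1 _ hq.2.2
      rw [show M + a + b = M + (a + b) by omega] at h1
      rw [show a + (M + b) = M + (a + b) by omega] at h2
      exact add_mem h1 h2⟩
  exact (bchTerm_prod_mem F (fun a b p hp q hq => by
    rw [Ring.lie_def]
    exact sub_mem (hmul a b p hp q hq) (by rw [add_comm]; exact hmul b a q hq p hp))
    ⟨hx, hx', hxx⟩ ⟨hy, hy', hyy⟩ n).2.2

/-- BCH has no linear part, so every term pairs the difference with at least one further factor from
step 1; agreement improves by one level. -/
theorem bch_sub_mem {x y x' y' : Conv K A} (hx : x ∈ vanishing K A 1)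
    (hy : y ∈ vanishing K A 1) (hx' : x' ∈ vanishing K A 1) (hy' : y' ∈ vanishing K A 1) {M : ℕ}
    (hxx : x - x' ∈ vanishing K A (M + 1)) (hyy : y - y' ∈ vanishing K A (M + 1)) :
    bch x y - bch x' y' ∈ vanishing K A (M + 2) := by
  have h1 := isSum_bch hx hy (M + 2)
  have h2 := isSum_bch hx' hy' (M + 2)
  have h3 : ∑ k ∈ Finset.range (M + 2), (bchDepth (K := K) x y (k + 1) -
      bchDepth (K := K) x' y' (k + 1)) ∈ vanishing K A (M + 2) := sum_mem fun k _ =>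
    vanishing_antitone (by omega) (bchTerm_sub_mem hx hy hx' hy' hxx hyy (k + 1 + 1))
  rw [Finset.sum_sub_distrib] at h3
  convert add_mem (sub_mem h1 h2) h3 using 1
  abel

/-- The fixed point equation has at most one solution. -/
theorem eq_of_bch_fixed {R S : A →ₗ[K] A} {Z χ χ' : Conv K A} (h : χ ∈ vanishing K A 1)
    (h' : χ' ∈ vanishing K A 1) (hf : χ = Z - bch (post R χ) (post S χ))
    (hf' : χ' = Z - bch (post R χ') (post S χ')) : χ = χ' := by
  have key : ∀ M, χ - χ' ∈ vanishing K A (M + 1) := by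
    intro M
    induction M with
    | zero => exact sub_mem h h'
    | succ M ih =>
      have hp : ∀ P : A →ₗ[K] A, post P χ - post P χ' ∈ vanishing K A (M + 1) := fun P => by
        rw [← postHom_apply, ← postHom_apply, ← map_sub]; exact post_mem_vanishing P ih
      have := bch_sub_mem (post_mem_vanishing R h) (post_mem_vanishing S h)
        (post_mem_vanishing R h') (post_mem_vanishing S h') (hp R) (hp S)
      have h2 : χ - χ' = -(bch (post R χ) (post S χ) - bch (post R χ') (post S χ')) := by
        conv_lhs => rw [hf, hf']
        abel
      rw [h2]
      exact neg_mem this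
  exact eq_of_sub_mem_vanishing fun N => vanishing_antitone (Nat.le_succ N) (key N)

/-- The right-hand side of the fixed point equation for `χ(u)`. -/
noncomputable def chiStep (R : A →ₗ[K] A) (Z : Conv K A) (χ : PowerSeries (Conv K A)) (n : ℕ) :
    Conv K A :=
  PowerSeries.coeff n (PowerSeries.C Z - ∑ k ∈ Finset.Icc 1 n, PowerSeries.X ^ k *
    bchDepth (K := K) (postSeries R χ) (postSeries (LinearMap.id - R) χ) k)

theorem chiStep_eq (R : A →ₗ[K] A) (Z : Conv K A) (χ : PowerSeries (Conv K A)) (n : ℕ) :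
    chiStep R Z χ n = (if n = 0 then Z else 0) - ∑ k ∈ Finset.Icc 1 n, PowerSeries.coeff (n - k)
      (bchDepth (K := K) (postSeries R χ) (postSeries (LinearMap.id - R) χ) k) := by
  rw [chiStep, map_sub, map_sum, PowerSeries.coeff_C]
  congr 1
  refine Finset.sum_congr rfl fun k hk => ?_
  rw [PowerSeries.coeff_X_pow_mul', if_pos (Finset.mem_Icc.1 hk).2]

theorem coeff_postSeries (P : A →ₗ[K] A) (χ : PowerSeries (Conv K A)) (n : ℕ) :
    PowerSeries.coeff n (postSeries P χ) = post P (PowerSeries.coeff n χ) := PowerSeries.coeff_mk _ _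

/-- Since k ≥ 1, the n-th coefficient involves the BCH terms only at degrees n - k < n, hence only
earlier coefficients of χ. -/
theorem exists_unique_isChiSeries (R : A →ₗ[K] A) (Z : Conv K A) :
    ∃ χ, IsChiSeries R Z χ ∧ ∀ χ', IsChiSeries R Z χ' → χ' = χ := by
  have : Inhabited (Conv K A) := ⟨0⟩
  obtain ⟨f, hf, huniq⟩ := existsUnique_recursion
    (fun f => chiStep R Z (PowerSeries.mk f)) fun f g n h => by
      rw [chiStep_eq, chiStep_eq]
      congr 1
      refine Finset.sum_congr rfl fun k hk => ?_
      have hP : ∀ P : A →ₗ[K] A, ∀ i < n, PowerSeries.coeff i (postSeries P (PowerSeries.mk f)) =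
          PowerSeries.coeff i (postSeries P (PowerSeries.mk g)) := fun P i hi => by
        rw [coeff_postSeries, coeff_postSeries, PowerSeries.coeff_mk, PowerSeries.coeff_mk, h i hi]
      rw [Finset.mem_Icc] at hk
      exact coeff_bchTerm_congr (hP R) (hP _) (k + 1) (n - k) (by omega)
  refine ⟨PowerSeries.mk f, fun n => (PowerSeries.coeff_mk _ _).trans (hf n), fun χ' h => ?_⟩
  have h2 : PowerSeries.mk (fun n => PowerSeries.coeff n χ') = χ' := by
    ext1 n; rw [PowerSeries.coeff_mk]
  rw [← h2, huniq (fun n => PowerSeries.coeff n χ') fun n => by rw [h2]; exact h n]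

/-- The power u^k comes with brackets of degree k + 1, so the k-th term contributes in level (n - k)
+ (k + 1) = n + 1. -/
theorem IsChiSeries.coeff_mem {R : A →ₗ[K] A} {Z : Conv K A} {χ : PowerSeries (Conv K A)}
    (h : IsChiSeries R Z χ) (hZ : IsInfChar Z) (n : ℕ) :
    PowerSeries.coeff n χ ∈ vanishing K A (n + 1) ⊓ infChar K A := by
  induction n using Nat.strong_induction_on with
  | _ n ih =>
    rw [show PowerSeries.coeff n χ = _ from (h n).trans (chiStep_eq R Z χ n)]
    refine sub_mem ?_ (sum_mem fun k hk => ?_)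
    · split_ifs with hn
      · subst hn; exact ⟨hZ.mem_vanishing, hZ⟩
      · exact zero_mem _
    · rw [Finset.mem_Icc] at hk
      have hP : ∀ P : A →ₗ[K] A, ∀ i < n, PowerSeries.coeff i (postSeries P χ) ∈
          vanishing K A (i + 1) ⊓ infChar K A := fun P i hi => by
        rw [coeff_postSeries]
        exact ⟨post_mem_vanishing P (ih i hi).1, post_mem_infChar P (ih i hi).2⟩
      have := coeff_bchTerm_mem (fun d => vanishing K A d ⊓ infChar K A)
        (fun a b x hx y hy => ⟨vanishing_lie _ _ _ hx.1 _ hy.1, infChar_lie hx.2 hy.2⟩)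
        (hP R) (hP (LinearMap.id - R)) (k + 1) (n - k) (by omega)
      rwa [show n - k + (k + 1) = n + 1 by omega] at this

theorem sum_Icc_one_eq_sum_range {M : Type*} [AddCommMonoid M] (f : ℕ → M) (n : ℕ) :
    ∑ k ∈ Finset.Icc 1 n, f k = ∑ k ∈ Finset.range n, f (k + 1) := by
  rw [Finset.range_eq_Ico, Finset.sum_Ico_add' f 0 n 1]
  rfl

/-- A double series, indexed by the explicit power u^k and the degree i inside the BCH term, is
summed in two ways: antidiagonals give the coefficients of χ(u), rows give the fixed point
expression. -/
theorem IsChiSeries.isSum {R : A →ₗ[K] A} {Z : Conv K A} {χ : PowerSeries (Conv K A)}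
    (hχ : IsChiSeries R Z χ) (hZ : IsInfChar Z) :
    IsSum (fun n => PowerSeries.coeff n χ)
      (Z - bch (post R (evalOne χ)) (post (LinearMap.id - R) (evalOne χ))) := by
  have hmem : ∀ n, PowerSeries.coeff n χ ∈ vanishing K A (n + 1) := fun n =>
    (hχ.coeff_mem hZ n).1
  have hv : IsSum (fun n => PowerSeries.coeff n χ) (evalOne χ) :=
    isSum_seriesSum fun n => vanishing_antitone (Nat.le_succ n) (hmem n)
  have hv1 : evalOne χ ∈ vanishing K A 1 := by
    have := add_mem (hv 1) (vanishing_antitone (by omega) (hmem 0))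
    simpa using this
  have hP : ∀ P : A →ₗ[K] A, ∀ i, PowerSeries.coeff i (postSeries P χ) ∈
      vanishing K A (i + 1) := fun P i => by
    rw [coeff_postSeries]; exact post_mem_vanishing P (hmem i)
  have hPsum : ∀ P : A →ₗ[K] A, IsSum (fun i => PowerSeries.coeff i (postSeries P χ))
      (post P (evalOne χ)) := fun P => by
    simp only [coeff_postSeries]; exact hv.post P
  set x := postSeries R χ with hx
  set y := postSeries (LinearMap.id - R) χ with hy
  have hB : ∀ k i, PowerSeries.coeff i (bchTerm K x y k) ∈ vanishing K A (i + k) := fun k i =>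
    coeff_bchTerm_mem (vanishing K A) vanishing_lie (m := i + 1) (fun j _ => hP R j)
      (fun j _ => hP _ j) k i (Nat.lt_succ_self i)
  -- Row 0 carries Z in degree 0; row k + 1 carries the term of depth k + 1, which is `bchTerm` at
  -- index k + 2.
  let c : ℕ → ℕ → Conv K A := fun k i => k.casesOn (if i = 0 then Z else 0) fun k =>
    -PowerSeries.coeff i (bchTerm K x y (k + 2))
  let d : ℕ → Conv K A := fun k => k.casesOn Z fun k =>
    -bchTerm K (post R (evalOne χ)) (post (LinearMap.id - R) (evalOne χ)) (k + 2)
  have hc : ∀ k i, c k i ∈ vanishing K A (k + i) := by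
    rintro (_ | k) i
    · change (if i = 0 then Z else 0) ∈ _
      split_ifs with hi
      · subst hi; exact mem_vanishing_zero _
      · exact zero_mem _
    · exact neg_mem (vanishing_antitone (by omega) (hB (k + 2) i))
  have hcd : ∀ k, IsSum (c k) (d k) := by
    rintro (_ | k)
    · have := IsSum.shift (f := c 0) (v := 0) (fun k => by simpa using hc 0 k) (fun N => by
        simp [c])
      simpa [c, d] using this
    · exact (isSum_coeff_bchTerm (fun i => vanishing_antitone (Nat.le_succ i) (hP R i))
        (fun i => vanishing_antitone (Nat.le_succ i) (hP _ i)) (hPsum R) (hPsum _) (k + 2)).neg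
  have hd : IsSum d
      (Z - bch (post R (evalOne χ)) (post (LinearMap.id - R) (evalOne χ))) := by
    rw [sub_eq_add_neg]
    refine IsSum.shift (f := d) ?_ (isSum_bch (post_mem_vanishing _ hv1)
      (post_mem_vanishing _ hv1)).neg
    rintro (_ | k)
    · exact mem_vanishing_zero _
    · exact neg_mem (vanishing_antitone (by omega) (bchTerm_mem_vanishing
        (post_mem_vanishing _ hv1) (post_mem_vanishing _ hv1) (k + 2)))
  convert IsSum.antidiagonal hc hcd hd using 2 with n
  rw [show PowerSeries.coeff n χ = _ from (hχ n).trans (chiStep_eq R Z χ n),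
    Finset.Nat.sum_antidiagonal_eq_sum_range_succ c, Finset.sum_range_succ',
    sum_Icc_one_eq_sum_range, add_comm, sub_eq_add_neg, ← Finset.sum_neg_distrib]
  rfl

end CK

/-! ### The main theorem -/

theorem proposition4p7 {K A : Type*} [Field K] [CharZero K] [CommRing A] [Algebra K A]
    (R : A →ₗ[K] A) (hR : CK.IsRotaBaxter (1 : K) R) :
    -- the exponential and BCH series of infinitesimal characters are pointwise finite sums
    (∀ W : CK.Conv K A, CK.IsInfChar W → CK.PointwiseFinite (CK.expTerm W)) ∧
    (∀ V W : CK.Conv K A, CK.IsInfChar V → CK.IsInfChar W →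
      CK.PointwiseFinite (CK.bchDepth (K := K) V W)) ∧
    ∀ Z : CK.Conv K A, CK.IsInfChar Z →
      -- `χ(u; Z)` is the unique formal power series that solves the fixed point equation
      ∃ χu : PowerSeries (CK.Conv K A), CK.IsChiSeries R Z χu ∧
        (∀ χu' : PowerSeries (CK.Conv K A), CK.IsChiSeries R Z χu' → χu' = χu) ∧
        CK.PointwiseFinite (fun n => PowerSeries.coeff n χu) ∧
        -- `χ = χ(1; Z)` is the unique infinitesimal character with `χ = Z - BCH(R χ, (id - R) χ)`
        ∃ χ : CK.Conv K A, χ = CK.evalOne χu ∧ CK.IsInfChar χ ∧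
          χ = Z - CK.bch (CK.post R χ) (CK.post (LinearMap.id - R) χ) ∧
          (∀ χ' : CK.Conv K A, CK.IsInfChar χ' →
            χ' = Z - CK.bch (CK.post R χ') (CK.post (LinearMap.id - R) χ') → χ' = χ) ∧
          -- the factorization
          CK.expStar Z =
            CK.expStar (CK.post R χ) * CK.expStar (CK.post (LinearMap.id - R) χ) := by
  refine ⟨fun W hW => CK.pointwiseFinite_of_mem (CK.expTerm_mem_vanishing hW.mem_vanishing),
    fun V W hV hW => CK.pointwiseFinite_of_mem fun k => CK.vanishing_antitone (Nat.le_succ k)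
      (CK.bchTerm_mem_vanishing hV.mem_vanishing hW.mem_vanishing (k + 1)), fun Z hZ => ?_⟩
  obtain ⟨χu, hχu, huniq⟩ := CK.exists_unique_isChiSeries R Z
  have hmem : ∀ n, PowerSeries.coeff n χu ∈ CK.vanishing K A n := fun n =>
    CK.vanishing_antitone (Nat.le_succ n) (hχu.coeff_mem hZ n).1
  have hsum : CK.IsSum (fun n => PowerSeries.coeff n χu) (CK.evalOne χu) :=
    CK.isSum_seriesSum hmem
  have hchar : CK.IsInfChar (CK.evalOne χu) := hsum.isInfChar fun n => (hχu.coeff_mem hZ n).2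
  -- Both sides are the sum of the same series of coefficients.
  have hfix := hsum.unique (hχu.isSum hZ)
  refine ⟨χu, hχu, huniq, CK.pointwiseFinite_of_mem hmem, CK.evalOne χu, rfl, hchar, hfix,
    fun χ' h' hf' => CK.eq_of_bch_fixed h'.mem_vanishing hchar.mem_vanishing hf' hfix, ?_⟩
  -- The product is the exponential of χ + BCH(Rχ, χ - Rχ), which equals Z by `hfix`.
  rw [CK.expStar_mul_expStar (CK.post_mem_vanishing _ hchar.mem_vanishing)
    (CK.post_mem_vanishing _ hchar.mem_vanishing), CK.post_add_post_id_sub]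
  congr 1
  rw [eq_sub_iff_add_eq] at hfix
  exact hfix.symm
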